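/- **Theorem 2 (Rate of ID).** Let $A,E,\beta,\gamma>0$, let $Q$ be the standard Gaussian tail function, $\bar\epsilon=2Q(\beta)$, and $N=\max\{0,\lceil\log_2(\gamma(A+2\beta))\rceil\}$. *Noise.* Let $K$ take the values $k\in\{-\lceil\gamma A\rceil,\dots,\lceil\gamma(A+2\beta)\rceil-1\}$ with probabilities $\frac1T\big[Q(\tfrac{k-\gamma\beta}{\gamma})-Q(\tfrac{k+1-\gamma\beta}{\gamma})\big]$, where $T=Q\big(\tfrac{-\lceil\gamma A\rceil-\gamma\beta}{\gamma}\big)-Q\big(\tfrac{\lceil\gamma(A+2\beta)\rceil-\gamma\beta}{\gamma}\big)$. Let $(Z_0^b,\dots,Z_{N-1}^b)$ be the $N$-bit binary representation of $K$ (of $2^N+K$ if $K<0$), and let $\alpha_i=\mathcal P\{Z_i^b=1\}$. *Channel.* The vector binary channel with erasures has input $\boldsymbol X^b=(X_0^b,\dots,X_{N-1}^b)\in\{0,1\}^N$. It is memoryless over time. In each use, the output is erased on all bit-pipes with probability $\epsilon(\boldsymbol X^b)$; otherwise bit-pipe $i$ outputs $Y_i^b=(X_i^b+Z_i^b+W_i^b)\bmod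 2$, where $W_0^b=0$, $W_{i+1}^b=(X_i^bZ_i^b+X_i^bW_i^b+Z_i^bW_i^b)\bmod 2$, and the noise is independent of the input and of the erasure. Here $\epsilon:\{0,1\}^N\to[0,1]$ is any function with $\epsilon(\boldsymbol x)\le\bar\epsilon$ whenever $\sum_i x_i2^i\le\gamma A$ (in particular, $\epsilon\equiv\bar\epsilon$ is allowed). *Scheme.* In the independent decoding (ID) scheme the message is split into $m_0,\dots,m_{N-1}$, and $m_i$ is encoded into the length-$n$ input sequence of bit-pipe $i$ by a code of its own. For $i=0,\dots,N-1$ in this order, $m_i$ is decoded from the output sequence of bit-pipe $i$ alone, after subtracting modulo $2$ the carry-over bits that are computed from the previous decisions and the unerased outputs of the lower bit-pipes. The rate is $\sum_i\frac1n\log_2M_i$, where $M_i$ is the number of messages $m_i$. *Rate.* Let $\mathsf h$ be the binary entropy function in bits and $p\circledast\alpha=p(1-\alpha)+(1-p)\alpha$. Let $\mathcal A$ be the set of $\boldsymbol p\in[0,1]^N$ with $\sum_{i:\,p_i>0}2^i\le\gamma A$ and $\sum_{i:\,p_i>0}p_i2^i\le\gamma E$. Then: 1. The maximum $S=\max_{\boldsymbol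 p\in\mathcal A}\sum_{i=0}^{N-1}\big(\mathsf h(p_i\circledast\alpha_i)-\mathsf h(\alpha_i)\big)$ is attained. 2. For every $\boldsymbol p\in\mathcal A$, the ID scheme with random codebooks whose symbols are independent, and Bernoulli$(p_i)$ on bit-pipe $i$ (with $M_i=1$ if $p_i=0$), achieves the rate $(1-\bar\epsilon)\sum_i(\mathsf h(p_i\circledast\alpha_i)-\mathsf h(\alpha_i))$: for every $\delta>0$ and all sufficiently large $n$ there are message set sizes $M_i\ge1$ of total rate at least this value minus $\delta$, and rules that make a decoder of each bit-pipe out of the codebook of that bit-pipe, such that each message tuple has error probability at most $\delta$ on average over the codebooks. 3. The rate $R_{\mathrm{ID}}=(1-\bar\epsilon)S$ is achievable by ID under the intensity constraints: for every $\delta>0$ and all sufficiently large $n$ there is a (deterministic) ID code of length $n$ and rate at least $R_{\mathrm{ID}}-\delta$ such that each transmitted sequence satisfies $\sum_iX_i^b(t)2^i\le\gamma A$ at all times $t$ and $\frac1n\sum_t\sum_iX_i^b(t)2^i\le\gamma E$, and the error probability averaged over the messages is at most $\delta$. If $\epsilon$ is constant, then the same holds with the maximal error probability over the messages. -/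

import Mathlib

noncomputable section

namespace VBC

/-! ### Parameters and the binary noise -/

/-- The standard Gaussian tail function. -/
def gaussQ (x : ℝ) : ℝ :=
  (Real.sqrt (2 * Real.pi))⁻¹ * ∫ u in Set.Ioi x, Real.exp (-u ^ 2 / 2)

/-- The upper bound `2 Q(β)` on the erasure probability. -/
def erasureBound (β : ℝ) : ℝ := 2 * gaussQ β

/-- The number of bit-pipes (it is `0` when `γ (A + 2 β) ≤ 1`, where the logarithm is `≤ 0`). -/
def numBits (A β γ : ℝ) : ℕ := ⌈Real.logb 2 (γ * (A + 2 * β))⌉₊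

/-- The integers `k` for which the unit interval `[k, k + 1)` is one of the quantization cells of
the biased and scaled noise `γ (Z + β)`, where `Z` is standard Gaussian. -/
def noiseSupport (A β γ : ℝ) : Finset ℤ :=
  Finset.Ico (-⌈γ * A⌉) ⌈γ * (A + 2 * β)⌉

/-- The normalization: the probability that `γ (Z + β)` lies in the union of the cells. -/
def noiseNorm (A β γ : ℝ) : ℝ :=
  gaussQ ((-(⌈γ * A⌉ : ℝ) - γ * β) / γ) - gaussQ (((⌈γ * (A + 2 * β)⌉ : ℝ) - γ * β) / γ)

/-- The probability that `γ (Z + β)` lies in the cell `[k, k + 1)`, given that it lies in the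
union of the cells. -/
def noiseMass (A β γ : ℝ) (k : ℤ) : ℝ :=
  (gaussQ (((k : ℝ) - γ * β) / γ) - gaussQ (((k : ℝ) + 1 - γ * β) / γ)) / noiseNorm A β γ

/-- The `i`-th bit of the `N`-bit representation of `k`, with two's complement for `k < 0`. -/
def noiseBits (N : ℕ) (k : ℤ) (i : Fin N) : Bool :=
  decide ((((if k < 0 then 2 ^ N else 0) + k) / 2 ^ (i : ℕ)) % 2 = 1)

/-- The crossover probability `α i`, the probability that the `i`-th noise bit is `1`. -/
def crossover (A β γ : ℝ) (N : ℕ) (i : Fin N) : ℝ :=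
  ∑ k ∈ (noiseSupport A β γ).filter (fun k => noiseBits N k i = true), noiseMass A β γ k

/-! ### The vector binary channel with erasures -/

/-- `(x z + x w + z w) mod 2`. -/
def carryBit (x z w : Bool) : Bool := xor (xor (x && z) (x && w)) (z && w)

/-- The carry-over bit `W i` produced by the input bits `x` and the noise bits `z`. -/
def carry {N : ℕ} (x z : Fin N → Bool) : ℕ → Bool
  | 0 => false
  | i + 1 => if h : i < N then carryBit (x ⟨i, h⟩) (z ⟨i, h⟩) (carry x z i) else false

/-- The unerased output `Y i = (X i + Z i + W i) mod 2`. -/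
def output {N : ℕ} (x z : Fin N → Bool) (i : Fin N) : Bool :=
  xor (xor (x i) (z i)) (carry x z i)

/-- The transition probabilities of one use of the channel. With probability `e x` the output is
erased (on all bit-pipes at once, output `none`); otherwise it is `output x z`, where `z` is the
vector of noise bits, independent of the input and of the erasure. -/
def trans (A β γ : ℝ) {N : ℕ} (e : (Fin N → Bool) → ℝ) (x : Fin N → Bool) :
    Option (Fin N → Bool) → ℝ
  | none => e x
  | some y => (1 - e x) *
      ∑ k ∈ (noiseSupport A β γ).filter (fun k => output x (noiseBits N k) = y), noiseMass A β γ k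

/-- The integer `∑ X i 2 ^ i` represented by the input bits (it is sent as the intensity
`X = (∑ X i 2 ^ i) / γ`). -/
def value {N : ℕ} (x : Fin N → Bool) : ℝ := ∑ i, if x i then (2 : ℝ) ^ (i : ℕ) else 0

/-! ### Independent encoding and independent (successive) decoding -/

/-- A code for the independent decoding scheme of length `n`: for each bit-pipe `i` an encoder of
the message `m i` and a decoder that sees one ternary sequence (`none` is the erasure) only. -/
structure IDCode (N n : ℕ) (M : Fin N → ℕ) where
  /-- The codewords of bit-pipe `i`. -/
  enc : (i : Fin N) → Fin (M i) → Fin n → Bool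
  /-- The decoder of bit-pipe `i`. -/
  dec : (i : Fin N) → (Fin n → Option Bool) → Fin (M i)

namespace IDCode

variable {N n : ℕ} {M : Fin N → ℕ}

/-- The channel input at time `t` for the messages `m`. -/
def input (C : IDCode N n M) (m : (i : Fin N) → Fin (M i)) (t : Fin n) (i : Fin N) : Bool :=
  C.enc i (m i) t

/-- The output sequence of bit-pipe `i` after the carry-over bits `w` have been subtracted. -/
def cleaned (y : Fin n → Option (Fin N → Bool)) (i : Fin N) (w : Fin n → Bool) :
    Fin n → Option Bool :=
  fun t => (y t).map (fun b => xor (b i) (w t))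

/-- The receiver's estimate of the carry-over bits into bit-pipe `i`: having decoded bit-pipe
`i - 1`, it re-encodes the decision, recovers the noise bits at the unerased times, and computes
the next carry-over bits from these. (At erased times the value is irrelevant.) -/
def carryEst (C : IDCode N n M) (y : Fin n → Option (Fin N → Bool)) : ℕ → Fin n → Bool
  | 0 => fun _ => false
  | i + 1 => fun t =>
      if h : i < N then
        let w := carryEst C y i
        let ybar := cleaned y ⟨i, h⟩ w
        let xhat := C.enc ⟨i, h⟩ (C.dec ⟨i, h⟩ ybar)
        match ybar t with
        | none => false
        | some b => carryBit (xhat t) (xor b (xhat t)) (w t)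
      else false

/-- The decoded messages. -/
def decode (C : IDCode N n M) (y : Fin n → Option (Fin N → Bool)) (i : Fin N) : Fin (M i) :=
  C.dec i (cleaned y i (C.carryEst y i))

open Classical in
/-- The probability over `n` memoryless uses of the channel that not all messages are decoded
correctly, when the messages `m` are sent. -/
def errorProb (A β γ : ℝ) (e : (Fin N → Bool) → ℝ) (C : IDCode N n M)
    (m : (i : Fin N) → Fin (M i)) : ℝ :=
  ∑ y : Fin n → Option (Fin N → Bool),
    if C.decode y = m then 0 else ∏ t, trans A β γ e (C.input m t) (y t)

/-- The error probability averaged over all messages. -/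
def avgErrorProb (A β γ : ℝ) (e : (Fin N → Bool) → ℝ) (C : IDCode N n M) : ℝ :=
  (∑ m : (i : Fin N) → Fin (M i), C.errorProb A β γ e m) / ∏ i, (M i : ℝ)

/-- The total rate in bits per channel use of messages of sizes `M i` sent in `n` uses. -/
def rate (n : ℕ) (M : Fin N → ℕ) : ℝ := ∑ i, Real.logb 2 (M i) / n

/-- Every transmitted sequence satisfies the peak constraint `X ≤ A` and the average constraint
(time average of `X` at most `E`). -/
def Feasible (A E γ : ℝ) (C : IDCode N n M) : Prop :=
  ∀ m : (i : Fin N) → Fin (M i),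
    (∀ t, value (C.input m t) ≤ γ * A) ∧ (∑ t, value (C.input m t)) ≤ n * (γ * E)

end IDCode

/-- The rate `R` is achievable by independent decoding: for each `δ > 0` and all large `n` there is
a code of rate at least `R - δ` that satisfies the constraints and has average error at most `δ`. -/
def AchievableAvg (A E β γ : ℝ) {N : ℕ} (e : (Fin N → Bool) → ℝ) (R : ℝ) : Prop :=
  ∀ δ > 0, ∃ n₀ : ℕ, ∀ n ≥ n₀, ∃ M : Fin N → ℕ, (∀ i, 0 < M i) ∧ R - δ ≤ IDCode.rate n M ∧
    ∃ C : IDCode N n M, C.Feasible A E γ ∧ C.avgErrorProb A β γ e ≤ δ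

/-- The same with the maximal error probability. -/
def AchievableMax (A E β γ : ℝ) {N : ℕ} (e : (Fin N → Bool) → ℝ) (R : ℝ) : Prop :=
  ∀ δ > 0, ∃ n₀ : ℕ, ∀ n ≥ n₀, ∃ M : Fin N → ℕ, (∀ i, 0 < M i) ∧ R - δ ≤ IDCode.rate n M ∧
    ∃ C : IDCode N n M, C.Feasible A E γ ∧ ∀ m, C.errorProb A β γ e m ≤ δ

/-- The probability of the codebooks `c` when all symbols are independent and those of bit-pipe
`i` are Bernoulli with parameter `p i`. -/
def codebookProb {N n : ℕ} {M : Fin N → ℕ} (p : Fin N → ℝ)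
    (c : (i : Fin N) → Fin (M i) → Fin n → Bool) : ℝ :=
  ∏ i, ∏ j, ∏ t, if c i j t then p i else 1 - p i

/-- The rate `R` is achieved by independent decoding with random codebooks that have independent
Bernoulli `p i` symbols on bit-pipe `i`; no information is sent on bit-pipes that are off. The rule
`D i` makes the decoder of bit-pipe `i` out of the codebook of that bit-pipe. The error probability
of each message is averaged over the codebooks. -/
def EnsembleAchieves (A β γ : ℝ) {N : ℕ} (e : (Fin N → Bool) → ℝ) (p : Fin N → ℝ) (R : ℝ) :
    Prop :=
  ∀ δ > 0, ∃ n₀ : ℕ, ∀ n ≥ n₀, ∃ M : Fin N → ℕ, (∀ i, 0 < M i) ∧ (∀ i, p i = 0 → M i = 1) ∧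
    R - δ ≤ IDCode.rate n M ∧
    ∃ D : (i : Fin N) → (Fin (M i) → Fin n → Bool) → (Fin n → Option Bool) → Fin (M i),
      ∀ m : (i : Fin N) → Fin (M i),
        (∑ c : (i : Fin N) → Fin (M i) → Fin n → Bool,
          codebookProb p c *
            (IDCode.mk c (fun i => D i (c i))).errorProb A β γ e m) ≤ δ

/-! ### The rate expression -/

/-- Binary entropy in bits. -/
def binEnt (p : ℝ) : ℝ := Real.binEntropy p / Real.log 2

/-- Binary convolution. -/
def bconv (p a : ℝ) : ℝ := p * (1 - a) + (1 - p) * a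

/-- The admissible parameters: bit-pipe `i` is on if `0 < p i`. -/
def Admissible (A E γ : ℝ) (N : ℕ) : Set (Fin N → ℝ) :=
  {p | (∀ i, 0 ≤ p i ∧ p i ≤ 1) ∧
    (∑ i ∈ Finset.univ.filter (fun i => 0 < p i), (2 : ℝ) ^ (i : ℕ)) ≤ γ * A ∧
    (∑ i ∈ Finset.univ.filter (fun i => 0 < p i), p i * (2 : ℝ) ^ (i : ℕ)) ≤ γ * E}

/-- `∑ i, (h (p i ⊛ α i) - h (α i))`. -/
def sumRate (A β γ : ℝ) {N : ℕ} (p : Fin N → ℝ) : ℝ :=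
  ∑ i, (binEnt (bconv (p i) (crossover A β γ N i)) - binEnt (crossover A β γ N i))

end VBC

end

/-
As long as all decisions on the lower bit-pipes are correct, the subtracted carry-over bits are the
true ones. The error probability of successive decoding is therefore at most the sum, over the
bit-pipes, of the error probabilities of a receiver that knows the carry-over bits. For that
receiver, after averaging over the random codebooks of the other bit-pipes, bit-pipe `i` is a
memoryless binary symmetric channel with crossover probability `α i` whose output is erased with a
probability that depends on the input bit only. Threshold decoding with the information density of
the unerased channel, together with a union bound and Chernoff's inequality, achieves the mean of
this density. The two input bits may be erased with different probabilities, but the mean given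
either bit is a divergence, hence nonnegative, so it drops by a factor of at least `1 - ε`; what
remains is `(1 - ε) (h (p i ⊛ α i) - h (α i))`.

For the intensity constraints, the codebooks are drawn with slightly smaller parameters, and the
few overweight codewords are replaced by zero sequences; a code that is good on average over the
codebooks and messages is then fixed. If the erasure probability is constant, the error probability
of bit-pipe `i` depends on `m i` only, so the worse half of the messages can be expurgated on each
bit-pipe separately.

The maximum exists because the admissible parameters form a finite union of compact sets, one for
each set of bit-pipes that may be on.
-/

namespace VBC

open Filter Topology

/-! ### Finite probability -/

section FiniteProbability

variable {S T : Type*} [Fintype S] [Fintype T]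

/-- The expectation of `F` under the law `w` on a finite type. Laws are real weight functions, as
in the channel model; that they are probability laws is stated by membership in `stdSimplex`. -/
def expect (w F : S → ℝ) : ℝ := ∑ s, w s * F s

/-- The probability of the event `B` under the law `w`. -/
noncomputable abbrev prob (w : S → ℝ) (B : Set S) : ℝ := expect w (B.indicator 1)

/-- The law of `g s` when `s` has the law `w`. -/
def pushforward [DecidableEq T] (g : S → T) (w : S → ℝ) (y : T) : ℝ := ∑ s with g s = y, w s

/-- The law of a pair whose first component has the law `w` and whose second component has the
conditional law `W s` given that the first one is `s`. -/
def joint (w : S → ℝ) (W : S → T → ℝ) (q : S × T) : ℝ := w q.1 * W q.1 q.2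

variable {w F G : S → ℝ}

theorem expect_mono (hw : ∀ s, 0 ≤ w s) (h : ∀ s, w s ≠ 0 → F s ≤ G s) :
    expect w F ≤ expect w G := by
  refine Finset.sum_le_sum fun s _ => ?_
  by_cases hs : w s = 0
  · simp [hs]
  · exact mul_le_mul_of_nonneg_left (h s hs) (hw s)

theorem expect_const (hw : ∑ s, w s = 1) (c : ℝ) : expect w (fun _ => c) = c := by
  rw [expect, ← Finset.sum_mul, hw, one_mul]

theorem expect_le_of_forall_le (hw : w ∈ stdSimplex ℝ S) {c : ℝ} (h : ∀ s, w s ≠ 0 → F s ≤ c) :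
    expect w F ≤ c :=
  (expect_mono hw.1 h).trans_eq (expect_const hw.2 c)

theorem expect_add (w F G : S → ℝ) :
    expect w (fun s => F s + G s) = expect w F + expect w G := by
  simp only [expect, mul_add, Finset.sum_add_distrib]

theorem expect_sum {ι : Type*} (w : S → ℝ) (I : Finset ι) (F : ι → S → ℝ) :
    expect w (fun s => ∑ i ∈ I, F i s) = ∑ i ∈ I, expect w (F i) := by
  simp only [expect, Finset.mul_sum]
  exact Finset.sum_comm

theorem expect_const_mul (w F : S → ℝ) (c : ℝ) :
    expect w (fun s => c * F s) = c * expect w F := by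
  simp only [expect, Finset.mul_sum, mul_left_comm]

theorem expect_comm (w : S → ℝ) (v : T → ℝ) (F : S → T → ℝ) :
    expect w (fun s => expect v (F s)) = expect v (fun t => expect w (fun s => F s t)) := by
  simp only [expect, Finset.mul_sum, mul_left_comm (w _)]
  exact Finset.sum_comm

theorem expect_joint (w : S → ℝ) (W : S → T → ℝ) (F : S × T → ℝ) :
    expect (joint w W) F = expect w (fun s => expect (W s) (fun t => F (s, t))) := by
  simp only [expect, joint, Fintype.sum_prod_type, Finset.mul_sum, mul_assoc]

theorem joint_mem_stdSimplex {W : S → T → ℝ} (hw : w ∈ stdSimplex ℝ S)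
    (hW : ∀ s, W s ∈ stdSimplex ℝ T) : joint w W ∈ stdSimplex ℝ (S × T) :=
  ⟨fun q => mul_nonneg (hw.1 q.1) ((hW q.1).1 q.2), by
    simp only [joint, Fintype.sum_prod_type, ← Finset.mul_sum, (hW _).2, mul_one, hw.2]⟩

theorem expect_pushforward [DecidableEq T] (g : S → T) (w : S → ℝ) (F : T → ℝ) :
    expect (pushforward g w) F = expect w (F ∘ g) := by
  simp only [expect, pushforward, Finset.sum_mul, Function.comp_apply]
  rw [← Finset.sum_fiberwise Finset.univ g]
  refine Finset.sum_congr rfl fun y _ => Finset.sum_congr rfl fun s hs => ?_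
  rw [(Finset.mem_filter.mp hs).2]

omit [Fintype T] in
theorem pushforward_apply [DecidableEq T] (g : S → T) (w : S → ℝ) (y : T) :
    pushforward g w y = expect w (fun s => if g s = y then 1 else 0) := by
  simp [pushforward, expect, Finset.sum_filter]

theorem pushforward_mem_stdSimplex [DecidableEq T] (g : S → T) (hw : w ∈ stdSimplex ℝ S) :
    pushforward g w ∈ stdSimplex ℝ T :=
  ⟨fun _ => Finset.sum_nonneg fun s _ => hw.1 s,
    (Finset.sum_fiberwise Finset.univ g w).trans hw.2⟩

theorem pushforward_snd_joint {U : Type*} [DecidableEq U] (w : S → ℝ) (W : S → T → ℝ)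
    (g : T → U) (y : U) :
    pushforward (fun q => g q.2) (joint w W) y = expect w (fun s => pushforward g (W s) y) := by
  simp only [pushforward_apply, expect_joint]

theorem exists_le_of_expect_le (hw : w ∈ stdSimplex ℝ S) {c : ℝ} (h : expect w F ≤ c) :
    ∃ s, F s ≤ c := by
  by_contra! hF
  obtain ⟨s, hs⟩ : ∃ s, w s ≠ 0 := by
    by_contra! h0
    simpa [h0] using hw.2
  have : expect w (fun _ => c) < expect w F :=
    Finset.sum_lt_sum (fun s _ => mul_le_mul_of_nonneg_left (hF s).le (hw.1 s))
      ⟨s, Finset.mem_univ s, mul_lt_mul_of_pos_left (hF s) ((hw.1 s).lt_of_ne' hs)⟩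
  rw [expect_const hw.2] at this
  exact this.not_ge h

theorem exists_sum_average_le {ι : Type*} [Fintype ι] {κ : ι → Type*} [∀ i, Fintype (κ i)]
    [∀ i, Nonempty (κ i)] (hw : w ∈ stdSimplex ℝ S) {F : (i : ι) → κ i → S → ℝ} {c : ℝ}
    (hF : ∀ i k, expect w (F i k) ≤ c) :
    ∃ s, ∑ i, (∑ k, F i k s) / Fintype.card (κ i) ≤ Fintype.card ι * c := by
  refine exists_le_of_expect_le hw ?_
  simp only [div_eq_inv_mul, expect_sum, expect_const_mul, ← nsmul_eq_mul]
  refine Finset.sum_le_card_nsmul _ _ _ fun i _ => ?_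
  rw [inv_mul_le_iff₀ (by exact_mod_cast Fintype.card_pos), ← nsmul_eq_mul]
  exact Finset.sum_le_card_nsmul _ _ _ fun k _ => hF i k

theorem prob_nonneg (hw : ∀ s, 0 ≤ w s) (B : Set S) : 0 ≤ prob w B :=
  Finset.sum_nonneg fun s _ =>
    mul_nonneg (hw s) (Set.indicator_nonneg (fun _ _ => zero_le_one) s)

theorem prob_mono (hw : ∀ s, 0 ≤ w s) {B C : Set S} (h : B ⊆ C) : prob w B ≤ prob w C :=
  expect_mono hw fun s _ => Set.indicator_le_indicator_of_subset h (fun _ => zero_le_one) s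

theorem prob_le_one (hw : w ∈ stdSimplex ℝ S) (B : Set S) : prob w B ≤ 1 :=
  expect_le_of_forall_le hw fun _ _ => Set.indicator_le_self' (fun _ _ => zero_le_one) _

theorem prob_union_le (hw : ∀ s, 0 ≤ w s) (B C : Set S) : prob w (B ∪ C) ≤ prob w B + prob w C := by
  rw [prob, ← expect_add]
  refine expect_mono hw fun s _ => ?_
  by_cases hB : s ∈ B <;> by_cases hC : s ∈ C <;> simp [hB, hC]

theorem prob_iUnion_le {ι : Type*} (hw : ∀ s, 0 ≤ w s) (I : Finset ι) (B : ι → Set S) :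
    prob w (⋃ i ∈ I, B i) ≤ ∑ i ∈ I, prob w (B i) := by
  rw [← expect_sum]
  refine expect_mono hw fun s _ => ?_
  have hB : ∀ i ∈ I, 0 ≤ (B i).indicator (1 : S → ℝ) s :=
    fun i _ => Set.indicator_nonneg (fun _ _ => zero_le_one) s
  by_cases hs : s ∈ ⋃ i ∈ I, B i
  · obtain ⟨i, hi, hsi⟩ := Set.mem_iUnion₂.mp hs
    rw [Set.indicator_of_mem hs, ← Set.indicator_of_mem hsi (1 : S → ℝ)]
    exact Finset.single_le_sum hB hi
  · rw [Set.indicator_of_notMem hs]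
    exact Finset.sum_nonneg hB

theorem expect_prob_comm (w : S → ℝ) (v : T → ℝ) (P : S → T → Prop) :
    expect w (fun s => prob v {t | P s t}) = expect v (fun t => prob w {s | P s t}) :=
  expect_comm w v fun s => {t | P s t}.indicator 1

theorem prob_le_expect_exp (hw : ∀ s, 0 ≤ w s) (F : S → ℝ) :
    prob w {s | 0 ≤ F s} ≤ expect w (fun s => Real.exp (F s)) := by
  refine expect_mono hw fun s _ => ?_
  by_cases hs : 0 ≤ F s
  · simp [Set.indicator, hs]
  · simp [Set.indicator, hs, Real.exp_nonneg]

theorem exists_expect_exp_lt_one (hw : ∑ s, w s = 1) (hF : expect w F < 0) :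
    ∃ l > 0, expect w (fun s => Real.exp (l * F s)) < 1 := by
  have hderiv : HasDerivAt (fun l => expect w (fun s => Real.exp (l * F s))) (expect w F) 0 := by
    refine HasDerivAt.fun_sum fun s _ => ?_
    simpa using (((hasDerivAt_id (0 : ℝ)).mul_const (F s)).exp).const_mul (w s)
  have hslope := hderiv.tendsto_slope_zero_right.eventually (gt_mem_nhds hF)
  obtain ⟨l, hl, hl0 : 0 < l⟩ := (hslope.and self_mem_nhdsWithin).exists
  refine ⟨l, hl0, sub_neg.mp ?_⟩
  have hmul : l⁻¹ * (expect w (fun s => Real.exp (l * F s)) - 1) < 0 := by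
    simpa [expect_const hw] using hl
  exact neg_of_mul_neg_right hmul (inv_pos.mpr hl0).le

end FiniteProbability

section ProductLaw

variable {ι : Type*} [Fintype ι] {κ : ι → Type*}

/-- The law of a family of independent random variables with laws `w i`. -/
def prodLaw (w : (i : ι) → κ i → ℝ) (x : (i : ι) → κ i) : ℝ := ∏ i, w i (x i)

/-- The law of a family, indexed by `ι`, of independent random variables with the common
law `V`. -/
abbrev iid (ι : Type*) [Fintype ι] {S : Type*} (V : S → ℝ) : (ι → S) → ℝ :=
  prodLaw fun _ : ι => V

variable [DecidableEq ι] [∀ i, Fintype (κ i)] {w : (i : ι) → κ i → ℝ}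

theorem expect_prodLaw_prod (w f : (i : ι) → κ i → ℝ) :
    expect (prodLaw w) (fun x => ∏ i, f i (x i)) = ∏ i, expect (w i) (f i) := by
  simp only [expect, prodLaw, ← Finset.prod_mul_distrib]
  rw [Finset.prod_univ_sum, Fintype.piFinset_univ]

theorem prodLaw_mem_stdSimplex (hw : ∀ i, w i ∈ stdSimplex ℝ (κ i)) :
    prodLaw w ∈ stdSimplex ℝ ((i : ι) → κ i) := by
  refine ⟨fun x => Finset.prod_nonneg fun i _ => (hw i).1 _, ?_⟩
  simpa [expect, (hw _).2] using expect_prodLaw_prod w fun _ _ => 1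

/-- The pair of a family and a fresh copy of its `a`-th member is exchangeable in that member. -/
theorem expect_prodLaw_resample {a : ι} (ha : ∑ u, w a u = 1) (F : ((i : ι) → κ i) → ℝ) :
    expect (prodLaw w) F =
      expect (prodLaw w) (fun c => expect (w a) (fun u => F (Function.update c a u))) := by
  let swap : ((i : ι) → κ i) × κ a → ((i : ι) → κ i) × κ a :=
    fun q => (Function.update q.1 a q.2, q.1 a)
  have swap_involutive : Function.Involutive swap := fun ⟨c, u⟩ => by simp [swap]
  have law_swap : ∀ q, joint (prodLaw w) (fun _ => w a) (swap q) =
      joint (prodLaw w) (fun _ => w a) q := by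
    rintro ⟨c, u⟩
    simp only [joint, prodLaw, swap, Function.apply_update (fun i => w i),
      Finset.prod_update_of_mem (Finset.mem_univ a),
      Finset.prod_eq_mul_prod_sdiff_singleton_of_mem (Finset.mem_univ a) (fun i => w i (c i))]
    ring
  calc expect (prodLaw w) F
      = expect (joint (prodLaw w) fun _ => w a) (fun q => F q.1) := by
        simp only [expect_joint, expect_const ha]
    _ = expect (joint (prodLaw w) fun _ => w a) (fun q => F (swap q).1) :=
        Fintype.sum_bijective swap swap_involutive.bijective _ _ fun q => by
          simp only [law_swap, swap_involutive q]
    _ = _ := expect_joint _ _ _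

theorem expect_prodLaw_eval (hw : ∀ i, w i ∈ stdSimplex ℝ (κ i)) (a : ι) (F : κ a → ℝ) :
    expect (prodLaw w) (fun c => F (c a)) = expect (w a) F := by
  rw [expect_prodLaw_resample (hw a).2]
  simp only [Function.update_self, expect_const (prodLaw_mem_stdSimplex hw).2]

theorem pushforward_eval_prodLaw [∀ i, DecidableEq (κ i)] (hw : ∀ i, w i ∈ stdSimplex ℝ (κ i))
    (a : ι) : pushforward (fun c => c a) (prodLaw w) = w a := by
  funext y
  rw [pushforward_apply, expect_prodLaw_eval hw a fun u => if u = y then 1 else 0]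
  simp [expect]

theorem expect_prodLaw_pushforward {τ : ι → Type*} [∀ i, Fintype (τ i)] [∀ i, DecidableEq (τ i)]
    (w : (i : ι) → κ i → ℝ) (g : (i : ι) → κ i → τ i) (F : ((i : ι) → τ i) → ℝ) :
    expect (prodLaw fun i => pushforward (g i) (w i)) F =
      expect (prodLaw w) (fun x => F fun i => g i (x i)) := by
  have hlaw : (prodLaw fun i => pushforward (g i) (w i)) = pushforward (Pi.map g) (prodLaw w) := by
    funext y
    simp only [prodLaw, pushforward, Finset.prod_univ_sum]
    refine Finset.sum_congr ?_ fun _ _ => rfl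
    ext x
    simp [funext_iff]
  rw [hlaw, expect_pushforward]
  rfl

theorem expect_prodLaw_joint {τ : ι → Type*} [∀ i, Fintype (τ i)] (w : (i : ι) → κ i → ℝ)
    (W : (i : ι) → κ i → τ i → ℝ) (F : ((i : ι) → κ i) → ((i : ι) → τ i) → ℝ) :
    expect (prodLaw w) (fun x => expect (prodLaw fun i => W i (x i)) (F x)) =
      expect (prodLaw fun i => joint (w i) (W i))
        (fun q => F (fun i => (q i).1) (fun i => (q i).2)) := by
  rw [← expect_joint (prodLaw w) (fun x => prodLaw fun i => W i (x i)) fun q => F q.1 q.2]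
  symm
  refine Fintype.sum_equiv (Equiv.arrowProdEquivProdArrow ι κ τ) _ _ fun q => ?_
  simp only [joint, prodLaw, Finset.prod_mul_distrib]
  rfl

theorem expect_prodLaw_swap {τ : Type*} [Fintype τ] [DecidableEq τ] {S : ι → τ → Type*}
    [∀ i t, Fintype (S i t)] (w : (i : ι) → (t : τ) → S i t → ℝ)
    (F : ((i : ι) → (t : τ) → S i t) → ℝ) :
    expect (prodLaw fun i => prodLaw (w i)) F =
      expect (prodLaw fun t => prodLaw fun i => w i t) (fun x => F fun i t => x t i) := by
  refine Fintype.sum_equiv (Equiv.piComm S) _ _ fun x => ?_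
  simp only [prodLaw]
  rw [Finset.prod_comm]
  rfl

theorem prob_le_sum_le (hw : ∀ i u, 0 ≤ w i u) (g : (i : ι) → κ i → ℝ) (r : ℝ) :
    prob (prodLaw w) {x | r ≤ ∑ i, g i (x i)} ≤
      Real.exp (-r) * ∏ i, expect (w i) (fun u => Real.exp (g i u)) := by
  have hset : {x : (i : ι) → κ i | r ≤ ∑ i, g i (x i)} = {x | 0 ≤ -r + ∑ i, g i (x i)} := by
    ext x
    simp only [Set.mem_ofPred_eq]
    constructor <;> intro h <;> linarith
  rw [hset, ← expect_prodLaw_prod, ← expect_const_mul]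
  refine (prob_le_expect_exp (fun x => Finset.prod_nonneg fun i _ => hw i _) _).trans_eq ?_
  simp only [Real.exp_add, Real.exp_sum]
  rfl

theorem exists_prob_sum_nonneg_le_pow {S : Type*} [Fintype S] {V g : S → ℝ}
    (hV : V ∈ stdSimplex ℝ S) (hg : expect V g < 0) :
    ∃ ρ ∈ Set.Ico (0 : ℝ) 1, ∀ n : ℕ,
      prob (iid (Fin n) V) {s | 0 ≤ ∑ t, g (s t)} ≤ ρ ^ n := by
  obtain ⟨l, hl, hlt⟩ := exists_expect_exp_lt_one hV.2 hg
  refine ⟨_, ⟨Finset.sum_nonneg fun s _ => mul_nonneg (hV.1 s) (Real.exp_pos _).le, hlt⟩,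
    fun n => ?_⟩
  have hset : {s : Fin n → S | 0 ≤ ∑ t, g (s t)} = {s | 0 ≤ ∑ t, l * g (s t)} := by
    ext s
    rw [Set.mem_ofPred_eq, Set.mem_ofPred_eq, ← Finset.mul_sum, mul_nonneg_iff_of_pos_left hl]
  rw [hset]
  exact (prob_le_sum_le (fun _ => hV.1) (fun _ s => l * g s) 0).trans_eq (by simp; rfl)

end ProductLaw

/-! ### Threshold decoding on a memoryless channel -/

section ThresholdDecoding

variable {X Y J : Type*} {n : ℕ}

/-- The decoder that chooses a message whose codeword has total score at least `r` with the
received sequence, and an arbitrary message if there is none. -/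
noncomputable def thresholdDecoder [Nonempty J] (f : X → Y → ℝ) (r : ℝ) (c : J → Fin n → X)
    (y : Fin n → Y) : J :=
  Classical.epsilon fun j => r ≤ ∑ t, f (c j t) (y t)

theorem setOf_thresholdDecoder_ne_subset [Fintype J] [DecidableEq J] [Nonempty J] (f : X → Y → ℝ)
    (r : ℝ) (c : J → Fin n → X) (j : J) :
    {y | thresholdDecoder f r c y ≠ j} ⊆ {y | ∑ t, f (c j t) (y t) < r} ∪
      ⋃ k ∈ Finset.univ.erase j, {y | r ≤ ∑ t, f (c k t) (y t)} := by
  intro y hy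
  by_cases hj : r ≤ ∑ t, f (c j t) (y t)
  · exact .inr (Set.mem_biUnion (Finset.mem_erase.mpr ⟨hy, Finset.mem_univ _⟩)
      (Classical.epsilon_spec (p := fun k => r ≤ ∑ t, f (c k t) (y t)) ⟨j, hj⟩))
  · exact .inl (not_le.mp hj)

variable [Fintype X] [Fintype Y] {V : X → ℝ} {W : X → Y → ℝ} {f : X → Y → ℝ} {r : ℝ}

theorem exists_expect_prob_score_lt_le_pow (hV : V ∈ stdSimplex ℝ X)
    (hW : ∀ x, W x ∈ stdSimplex ℝ Y) (hr : r < expect (joint V W) fun q => f q.1 q.2) :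
    ∃ ρ ∈ Set.Ico (0 : ℝ) 1, ∀ n : ℕ,
      expect (iid (Fin n) V) (fun x =>
        prob (prodLaw fun t => W (x t)) {y | ∑ t, f (x t) (y t) < n * r}) ≤ ρ ^ n := by
  have hVW := joint_mem_stdSimplex hV hW
  have hmean : expect (joint V W) (fun q => r + -1 * f q.1 q.2) < 0 := by
    rw [expect_add, expect_const hVW.2, expect_const_mul]
    linarith
  obtain ⟨ρ, hρ, hpow⟩ := exists_prob_sum_nonneg_le_pow hVW hmean
  refine ⟨ρ, hρ, fun n => le_trans ?_ (hpow n)⟩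
  rw [expect_prodLaw_joint (fun _ : Fin n => V) (fun _ => W)
    fun x => {y | ∑ t, f (x t) (y t) < n * r}.indicator 1]
  refine expect_mono (prodLaw_mem_stdSimplex fun _ => hVW).1 fun q _ => ?_
  by_cases hq : ∑ t, f (q t).1 (q t).2 < n * r
  · have hq' : 0 ≤ ∑ t, (r + -1 * f (q t).1 (q t).2) := by
      simpa [Finset.sum_add_distrib] using hq.le
    rw [Set.indicator_of_mem (by exact hq), Set.indicator_of_mem (by exact hq')]
    rfl
  · rw [Set.indicator_of_notMem (by exact hq)]
    exact Set.indicator_nonneg (fun _ _ => zero_le_one) _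

omit [Fintype Y] in
theorem prob_le_score_le (hV : V ∈ stdSimplex ℝ X)
    (hf : ∀ y, expect V (fun x => Real.exp (f x y)) ≤ 1) (r : ℝ) (y : Fin n → Y) :
    prob (iid (Fin n) V) {x | r ≤ ∑ t, f (x t) (y t)} ≤ Real.exp (-r) :=
  (prob_le_sum_le (fun _ => hV.1) (fun t x => f x (y t)) r).trans <|
    mul_le_of_le_one_right (Real.exp_pos _).le <| Finset.prod_le_one
      (fun _ _ => Finset.sum_nonneg fun x _ => mul_nonneg (hV.1 x) (Real.exp_pos _).le)
      fun t _ => hf (y t)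

variable [Fintype J] [DecidableEq J]

theorem expect_prob_le_score_le (hV : V ∈ stdSimplex ℝ X) (hW : ∀ x, W x ∈ stdSimplex ℝ Y)
    (hf : ∀ y, expect V (fun x => Real.exp (f x y)) ≤ 1) (r : ℝ) {j k : J} (hjk : j ≠ k) :
    expect (iid J (iid (Fin n) V)) (fun c =>
      prob (prodLaw fun t => W (c j t)) {y | r ≤ ∑ t, f (c k t) (y t)}) ≤ Real.exp (-r) := by
  have hword := prodLaw_mem_stdSimplex fun _ : Fin n => hV
  rw [expect_prodLaw_resample (a := k) hword.2]
  refine expect_le_of_forall_le (prodLaw_mem_stdSimplex fun _ => hword) fun c _ => ?_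
  simp only [Function.update_self, Function.update_of_ne hjk]
  rw [expect_prob_comm]
  exact expect_le_of_forall_le (prodLaw_mem_stdSimplex fun t => hW (c j t))
    fun y _ => prob_le_score_le hV hf r y

variable [Nonempty J]

theorem expect_prob_thresholdDecoder_ne_le (hV : V ∈ stdSimplex ℝ X)
    (hW : ∀ x, W x ∈ stdSimplex ℝ Y) (hf : ∀ y, expect V (fun x => Real.exp (f x y)) ≤ 1)
    (r : ℝ) (j : J) :
    expect (iid J (iid (Fin n) V)) (fun c =>
      prob (prodLaw fun t => W (c j t)) {y | thresholdDecoder f r c y ≠ j}) ≤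
    expect (iid (Fin n) V) (fun x =>
      prob (prodLaw fun t => W (x t)) {y | ∑ t, f (x t) (y t) < r}) +
      (Fintype.card J - 1) * Real.exp (-r) := by
  have hword := prodLaw_mem_stdSimplex fun _ : Fin n => hV
  have hunion (c : J → Fin n → X) :
      prob (prodLaw fun t => W (c j t)) {y | thresholdDecoder f r c y ≠ j} ≤
      prob (prodLaw fun t => W (c j t)) {y | ∑ t, f (c j t) (y t) < r} +
        ∑ k ∈ Finset.univ.erase j,
          prob (prodLaw fun t => W (c j t)) {y | r ≤ ∑ t, f (c k t) (y t)} := by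
    have hQ := (prodLaw_mem_stdSimplex fun t => hW (c j t)).1
    refine (prob_mono hQ (setOf_thresholdDecoder_ne_subset f r c j)).trans ?_
    exact (prob_union_le hQ _ _).trans (add_le_add_right (prob_iUnion_le hQ _ _) _)
  refine (expect_mono (prodLaw_mem_stdSimplex fun _ => hword).1 fun c _ => hunion c).trans ?_
  rw [expect_add, expect_sum, expect_prodLaw_eval (fun _ => hword) j fun x =>
    prob (prodLaw fun t => W (x t)) {y | ∑ t, f (x t) (y t) < r}]
  refine add_le_add_right ((Finset.sum_le_card_nsmul _ _ (Real.exp (-r)) fun k hk =>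
    expect_prob_le_score_le hV hW hf r (Finset.ne_of_mem_erase hk).symm).trans_eq ?_) _
  rw [Finset.card_erase_of_mem (Finset.mem_univ _), Finset.card_univ, nsmul_eq_mul,
    Nat.cast_pred Fintype.card_pos]

omit [Fintype J] [DecidableEq J] [Nonempty J] in
/-- Shannon's random coding theorem, for a score `f` that need not be the information density. -/
theorem eventually_exists_decoder_expect_prob_ne_le (hV : V ∈ stdSimplex ℝ X)
    (hW : ∀ x, W x ∈ stdSimplex ℝ Y) (hf : ∀ y, expect V (fun x => Real.exp (f x y)) ≤ 1)
    {R δ : ℝ} (hR : R < expect (joint V W) fun q => f q.1 q.2) (hδ : 0 < δ) :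
    ∀ᶠ n : ℕ in atTop, ∀ K : ℕ, 0 < K → (K : ℝ) - 1 ≤ Real.exp (n * R) →
      ∃ D : (Fin K → Fin n → X) → (Fin n → Y) → Fin K, ∀ j,
        expect (iid (Fin K) (iid (Fin n) V)) (fun c =>
          prob (prodLaw fun t => W (c j t)) {y | D c y ≠ j}) ≤ δ := by
  obtain ⟨r, hRr, hr⟩ := exists_between hR
  obtain ⟨ρ, hρ, hpow⟩ := exists_expect_prob_score_lt_le_pow hV hW hr
  have hlim : Tendsto (fun n : ℕ => ρ ^ n + Real.exp (R - r) ^ n) atTop (𝓝 0) := by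
    simpa using (tendsto_pow_atTop_nhds_zero_of_lt_one hρ.1 hρ.2).add
      (tendsto_pow_atTop_nhds_zero_of_lt_one (Real.exp_pos _).le
        (Real.exp_lt_one_iff.mpr (sub_neg.mpr hRr)))
  filter_upwards [hlim.eventually_le_const hδ] with n hn K hK hcard
  have : Nonempty (Fin K) := ⟨⟨0, hK⟩⟩
  refine ⟨thresholdDecoder f (n * r), fun j =>
    (expect_prob_thresholdDecoder_ne_le hV hW hf _ j).trans ((add_le_add (hpow n) ?_).trans hn)⟩
  calc ((Fintype.card (Fin K) : ℝ) - 1) * Real.exp (-(n * r))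
      ≤ Real.exp (n * R) * Real.exp (-(n * r)) := by
        rw [Fintype.card_fin]
        gcongr
    _ = Real.exp (R - r) ^ n := by
        rw [← Real.exp_add, ← Real.exp_nat_mul]
        ring_nf

end ThresholdDecoding

/-! ### A bit-pipe as a binary symmetric channel with erasures -/

section BitPipe

theorem expect_log_div_nonneg {S : Type*} [Fintype S] {w v : S → ℝ} (hw : w ∈ stdSimplex ℝ S)
    (hv : v ∈ stdSimplex ℝ S) (hpos : ∀ s, 0 < v s) :
    0 ≤ expect w (fun s => Real.log (w s / v s)) := by
  have hsum : 0 ≤ ∑ s, v s * InformationTheory.klFun (w s / v s) := Finset.sum_nonneg fun s _ =>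
    mul_nonneg (hpos s).le (InformationTheory.klFun_nonneg (div_nonneg (hw.1 s) (hpos s).le))
  refine hsum.trans_eq ?_
  have hterm : ∀ s, v s * InformationTheory.klFun (w s / v s) =
      w s * Real.log (w s / v s) + v s - w s := fun s => by
    have := (hpos s).ne'
    rw [InformationTheory.klFun]
    field_simp
  simp [hterm, expect, Finset.sum_add_distrib, Finset.sum_sub_distrib, hw.2, hv.2]

/-- The Bernoulli law on bits. -/
noncomputable def bern (p : ℝ) (b : Bool) : ℝ := if b then p else 1 - p

/-- The transition probabilities of a binary symmetric channel with crossover probability `a`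
whose output is erased with a probability `η b` that may depend on the input bit `b`. -/
noncomputable def erasureChannel (η : Bool → ℝ) (a : ℝ) (b : Bool) : Option Bool → ℝ
  | none => η b
  | some v => (1 - η b) * bern a (xor v b)

/-- The information density (in nats) between a Bernoulli `p` bit `b` and the output of the
channel for this bit. It vanishes at an erasure, and it ignores how likely erasures are: the
decoder need not know their probability. -/
noncomputable def infoDensity (p a : ℝ) (b : Bool) : Option Bool → ℝ
  | none => 0
  | some v => Real.log (bern a (xor v b) / bern (bconv p a) v)

variable {p a ε : ℝ} {η : Bool → ℝ}

theorem bern_mem_stdSimplex (hp : p ∈ Set.Icc 0 1) : bern p ∈ stdSimplex ℝ Bool := by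
  refine ⟨fun b => ?_, by simp [bern]⟩
  cases b <;> simp [bern, hp.1, hp.2]

theorem bern_pos (hp : p ∈ Set.Ioo 0 1) (b : Bool) : 0 < bern p b := by
  cases b <;> simp [bern, hp.1, hp.2]

theorem eq_false_of_bern_zero_ne_zero {b : Bool} (hb : bern 0 b ≠ 0) : b = false := by
  simpa [bern] using hb

theorem bern_xor_mem_stdSimplex (ha : a ∈ Set.Icc 0 1) (b : Bool) :
    (fun v => bern a (xor v b)) ∈ stdSimplex ℝ Bool :=
  ⟨fun _ => (bern_mem_stdSimplex ha).1 _, by cases b <;> simp [bern]⟩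

theorem bconv_mem_Ioo (hp : p ∈ Set.Icc 0 1) (ha : a ∈ Set.Ioo 0 1) :
    bconv p a ∈ Set.Ioo 0 1 := by
  have ha' : 1 - a ∈ Set.Ioo (0 : ℝ) 1 := ⟨sub_pos.mpr ha.2, sub_lt_self _ ha.1⟩
  simpa [bconv] using convex_Ioo 0 1 ha' ha hp.1 (sub_nonneg.mpr hp.2) (add_sub_cancel p 1)

theorem erasureChannel_mem_stdSimplex (hη : ∀ b, η b ∈ Set.Icc 0 1) (ha : a ∈ Set.Icc 0 1)
    (b : Bool) : erasureChannel η a b ∈ stdSimplex ℝ (Option Bool) := by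
  refine ⟨fun y => ?_, ?_⟩
  · cases y with
    | none => exact (hη b).1
    | some v => exact mul_nonneg (sub_nonneg.mpr (hη b).2) ((bern_xor_mem_stdSimplex ha b).1 v)
  · simp only [Fintype.sum_option, erasureChannel, ← Finset.mul_sum]
    rw [(bern_xor_mem_stdSimplex ha b).2]
    ring

theorem expect_bern_exp_infoDensity (hp : p ∈ Set.Icc 0 1) (ha : a ∈ Set.Ioo 0 1)
    (y : Option Bool) : expect (bern p) (fun b => Real.exp (infoDensity p a b y)) = 1 := by
  cases y with
  | none => simp [infoDensity, expect, bern]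
  | some v =>
    have hv := bern_pos (bconv_mem_Ioo hp ha) v
    simp only [expect, infoDensity, Real.exp_log (div_pos (bern_pos ha _) hv), ← mul_div_assoc]
    rw [← Finset.sum_div, div_eq_one_iff_eq hv.ne']
    cases v
    · simp [bern, bconv]
      ring
    · simp [bern, bconv]

theorem expect_erasureChannel_infoDensity (b : Bool) :
    expect (erasureChannel η a b) (infoDensity p a b) =
      (1 - η b) * expect (fun v => bern a (xor v b))
        (fun v => Real.log (bern a (xor v b) / bern (bconv p a) v)) := by
  simp only [expect, Fintype.sum_option, erasureChannel, infoDensity, mul_zero, zero_add,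
    Finset.mul_sum, mul_assoc]

theorem expect_bern_log_div (hp : p ∈ Set.Icc 0 1) (ha : a ∈ Set.Ioo 0 1) :
    expect (bern p) (fun b => expect (fun v => bern a (xor v b))
      (fun v => Real.log (bern a (xor v b) / bern (bconv p a) v))) =
      Real.binEntropy (bconv p a) - Real.binEntropy a := by
  have hq := bconv_mem_Ioo hp ha
  simp only [expect, Real.log_div (bern_pos ha _).ne' (bern_pos hq _).ne', Fintype.sum_bool]
  simp only [bern, Bool.xor_true, Bool.xor_false, Bool.not_true, Bool.not_false, if_true,
    Bool.false_eq_true, if_false, Real.binEntropy, Real.log_inv]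
  generalize Real.log (1 - bconv p a) = L₁, Real.log (bconv p a) = L₂
  rw [bconv]
  ring

theorem le_expect_infoDensity (hp : p ∈ Set.Icc 0 1) (ha : a ∈ Set.Ioo 0 1)
    (hε : ∀ b, bern p b ≠ 0 → η b ≤ ε) :
    (1 - ε) * (Real.binEntropy (bconv p a) - Real.binEntropy a) ≤
      expect (joint (bern p) (erasureChannel η a)) (fun q => infoDensity p a q.1 q.2) := by
  rw [expect_joint, ← expect_bern_log_div hp ha, ← expect_const_mul]
  refine expect_mono (bern_mem_stdSimplex hp).1 fun b hb => ?_
  rw [expect_erasureChannel_infoDensity]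
  refine mul_le_mul_of_nonneg_right (sub_le_sub_left (hε b hb) 1) ?_
  exact expect_log_div_nonneg (bern_xor_mem_stdSimplex (Set.Ioo_subset_Icc_self ha) b)
    (bern_mem_stdSimplex (Set.Ioo_subset_Icc_self (bconv_mem_Ioo hp ha)))
    (bern_pos (bconv_mem_Ioo hp ha))

theorem eventually_exists_random_code_erasureChannel (hp : p ∈ Set.Icc 0 1)
    (ha : a ∈ Set.Ioo 0 1) (hη : ∀ b, η b ∈ Set.Icc 0 1) (hε : ∀ b, bern p b ≠ 0 → η b ≤ ε)
    {δ : ℝ} (hδ : 0 < δ) :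
    ∀ᶠ n : ℕ in atTop, ∃ K : ℕ, 0 < K ∧ (p = 0 → K = 1) ∧
      (1 - ε) * (binEnt (bconv p a) - binEnt a) - δ ≤ Real.logb 2 K / n ∧
      ∃ D : (Fin K → Fin n → Bool) → (Fin n → Option Bool) → Fin K, ∀ j,
        expect (iid (Fin K) (iid (Fin n) (bern p))) (fun c =>
          prob (prodLaw fun t => erasureChannel η a (c j t)) {y | D c y ≠ j}) ≤ δ := by
  have hlog : 0 < Real.log 2 := Real.log_pos one_lt_two
  set R := (1 - ε) * (Real.binEntropy (bconv p a) - Real.binEntropy a) - δ * Real.log 2 with hR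
  have hrate : (1 - ε) * (binEnt (bconv p a) - binEnt a) - δ = R / Real.log 2 := by
    rw [hR, binEnt, binEnt]
    field_simp
  have hRlt : R < expect (joint (bern p) (erasureChannel η a))
      (fun q => infoDensity p a q.1 q.2) :=
    (sub_lt_self _ (mul_pos hδ hlog)).trans_le (le_expect_infoDensity hp ha hε)
  filter_upwards [eventually_gt_atTop 0, eventually_exists_decoder_expect_prob_ne_le
    (bern_mem_stdSimplex hp) (erasureChannel_mem_stdSimplex hη (Set.Ioo_subset_Icc_self ha))
    (fun y => (expect_bern_exp_infoDensity hp ha y).le) hRlt hδ] with n hn hD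
  by_cases hp0 : p = 0
  · refine ⟨1, one_pos, fun _ => rfl, ?_, hD 1 one_pos (by simp [Real.exp_nonneg])⟩
    simp [hp0, bconv, hδ.le]
  · have hceil := Nat.le_ceil (Real.exp (n * R))
    have hK : 0 < ⌈Real.exp (n * R)⌉₊ := Nat.ceil_pos.mpr (Real.exp_pos _)
    refine ⟨⌈Real.exp (n * R)⌉₊, hK, fun h => absurd h hp0, ?_, hD _ hK ?_⟩
    · have hn' : (0 : ℝ) < n := Nat.cast_pos.mpr hn
      have hlogK : n * R ≤ Real.log ⌈Real.exp (n * R)⌉₊ :=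
        (Real.le_log_iff_exp_le (Nat.cast_pos.mpr hK)).mpr hceil
      rw [hrate, Real.logb, div_right_comm, div_le_div_iff_of_pos_right hlog, le_div_iff₀ hn']
      linarith
    · linarith [Nat.ceil_lt_add_one (Real.exp_nonneg (n * R))]

end BitPipe

/-! ### Random codebooks and a receiver that knows the carry-over bits -/

section RandomCodebooks

variable {N n : ℕ} {M : Fin N → ℕ} {p a : Fin N → ℝ} {μ e : (Fin N → Bool) → ℝ} {ε : ℝ}

/-- The law of independent Bernoulli `p i` bits. -/
noncomputable abbrev inputLaw (p : Fin N → ℝ) : (Fin N → Bool) → ℝ := prodLaw fun i => bern (p i)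

/-- The law of the channel state for the input `x`: an erasure (`none`), or the noise bits `z` and
no erasure (`some z`), where `z` has the law `μ`. -/
noncomputable def stateLaw (μ e : (Fin N → Bool) → ℝ) (x : Fin N → Bool) :
    Option (Fin N → Bool) → ℝ
  | none => e x
  | some z => (1 - e x) * μ z

/-- The output of bit-pipe `i` for its input bit `b` in the channel state `s`, when the carry-over
bit has been subtracted correctly. -/
def pipeOutput (i : Fin N) (b : Bool) (s : Option (Fin N → Bool)) : Option Bool :=
  s.map fun z => xor b (z i)

/-- The probability that the decoder `d` of bit-pipe `i` misses the message `j` when the sequence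
`x` is transmitted and the carry-over bits have been subtracted correctly. -/
noncomputable def pipeError (μ e : (Fin N → Bool) → ℝ) (x : Fin n → Fin N → Bool) (i : Fin N)
    {K : ℕ} (d : (Fin n → Option Bool) → Fin K) (j : Fin K) : ℝ :=
  prob (prodLaw fun t => stateLaw μ e (x t)) {s | d (fun t => pipeOutput i (x t i) (s t)) ≠ j}

/-- The erasure probability for the input bit `b` of bit-pipe `i`, when the other bit-pipes have
independent Bernoulli `p i` inputs. -/
noncomputable def pipeErasure (p : Fin N → ℝ) (e : (Fin N → Bool) → ℝ) (i : Fin N) (b : Bool) :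
    ℝ :=
  expect (inputLaw p) fun x => e (Function.update x i b)

theorem stateLaw_mem_stdSimplex (hμ : μ ∈ stdSimplex ℝ (Fin N → Bool))
    (he : ∀ x, e x ∈ Set.Icc 0 1) (x : Fin N → Bool) :
    stateLaw μ e x ∈ stdSimplex ℝ (Option (Fin N → Bool)) := by
  refine ⟨fun s => ?_, by simp [Fintype.sum_option, stateLaw, ← Finset.mul_sum, hμ.2]⟩
  cases s with
  | none => exact (he x).1
  | some z => exact mul_nonneg (sub_nonneg.mpr (he x).2) (hμ.1 z)

theorem inputLaw_mem_stdSimplex (hp : ∀ i, p i ∈ Set.Icc 0 1) :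
    inputLaw p ∈ stdSimplex ℝ (Fin N → Bool) :=
  prodLaw_mem_stdSimplex fun i => bern_mem_stdSimplex (hp i)

theorem pipeErasure_mem_Icc (hp : ∀ i, p i ∈ Set.Icc 0 1) (he : ∀ x, e x ∈ Set.Icc 0 1)
    (i : Fin N) (b : Bool) : pipeErasure p e i b ∈ Set.Icc 0 1 :=
  ⟨Finset.sum_nonneg fun x _ => mul_nonneg ((inputLaw_mem_stdSimplex hp).1 x) (he _).1,
    expect_le_of_forall_le (inputLaw_mem_stdSimplex hp) fun _ _ => (he _).2⟩

theorem pipeErasure_le (hp : ∀ i, p i ∈ Set.Icc 0 1)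
    (hε : ∀ x : Fin N → Bool, (∀ i, bern (p i) (x i) ≠ 0) → e x ≤ ε) {i : Fin N} {b : Bool}
    (hb : bern (p i) b ≠ 0) : pipeErasure p e i b ≤ ε := by
  refine expect_le_of_forall_le (inputLaw_mem_stdSimplex hp) fun x hx => hε _ ?_
  rw [Function.forall_update_iff x (fun k v => bern (p k) v ≠ 0)]
  exact ⟨hb, fun k _ => Finset.prod_ne_zero_iff.mp hx k (Finset.mem_univ k)⟩

theorem pushforward_pipeOutput_stateLaw {i : Fin N} {a : ℝ}
    (hμ : pushforward (fun z => z i) μ = bern a) (b : Bool) (x : Fin N → Bool) :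
    pushforward (pipeOutput i b) (stateLaw μ e x) = erasureChannel (fun _ => e x) a b := by
  funext y
  rw [pushforward_apply, expect, Fintype.sum_option]
  cases y with
  | none => simp [stateLaw, pipeOutput, erasureChannel]
  | some v =>
    have hxor : ∀ z : Fin N → Bool, xor b (z i) = v ↔ z i = xor v b := fun z => by
      cases b <;> cases v <;> simp
    simp only [stateLaw, pipeOutput, erasureChannel, ← hμ, pushforward_apply, expect, hxor,
      Option.map_none, Option.map_some, Option.some.injEq, reduceCtorEq, if_false, mul_zero,
      zero_add, mul_assoc, Finset.mul_sum]

theorem pushforward_pipeOutput_joint (hp : ∀ i, p i ∈ Set.Icc 0 1) {i : Fin N} {a : ℝ}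
    (hμ : pushforward (fun z => z i) μ = bern a) (b : Bool) :
    pushforward (fun q => pipeOutput i b q.2)
      (joint (inputLaw p) fun x => stateLaw μ e (Function.update x i b)) =
      erasureChannel (pipeErasure p e i) a b := by
  funext y
  rw [pushforward_snd_joint]
  simp only [pushforward_pipeOutput_stateLaw hμ]
  cases y with
  | none => rfl
  | some v =>
    simp only [erasureChannel, pipeErasure, expect, sub_mul, one_mul, mul_sub,
      Finset.sum_sub_distrib, Finset.sum_mul, mul_assoc]
    rw [← Finset.sum_mul, (inputLaw_mem_stdSimplex hp).2, one_mul]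

theorem codebookProb_eq_prodLaw (p : Fin N → ℝ) :
    (codebookProb p : ((i : Fin N) → Fin (M i) → Fin n → Bool) → ℝ) =
      prodLaw fun i => iid (Fin (M i)) (iid (Fin n) (bern (p i))) :=
  rfl

theorem codebookProb_mem_stdSimplex (hp : ∀ i, p i ∈ Set.Icc 0 1) :
    codebookProb p ∈ stdSimplex ℝ ((i : Fin N) → Fin (M i) → Fin n → Bool) :=
  prodLaw_mem_stdSimplex fun i => prodLaw_mem_stdSimplex fun _ => prodLaw_mem_stdSimplex fun _ =>
    bern_mem_stdSimplex (hp i)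

theorem expect_codebookProb_codewords (hp : ∀ i, p i ∈ Set.Icc 0 1) (m : (i : Fin N) → Fin (M i))
    (G : (Fin n → Fin N → Bool) → ℝ) :
    expect (codebookProb p) (fun c => G fun t i => c i (m i) t) =
      expect (iid (Fin n) (inputLaw p)) G := by
  rw [codebookProb_eq_prodLaw, ← expect_prodLaw_pushforward
    (fun i => iid (Fin (M i)) (iid (Fin n) (bern (p i)))) (fun i c => c (m i))
    (fun x => G fun t i => x i t)]
  simp only [pushforward_eval_prodLaw fun _ =>
    prodLaw_mem_stdSimplex fun _ => bern_mem_stdSimplex (hp _)]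
  exact expect_prodLaw_swap (fun i _ => bern (p i)) _

theorem expect_prob_pipeOutput_update (hp : ∀ i, p i ∈ Set.Icc 0 1) {i : Fin N} {a : ℝ}
    (hμ : pushforward (fun z => z i) μ = bern a) (b : Fin n → Bool)
    (B : Set (Fin n → Option Bool)) :
    expect (iid (Fin n) (inputLaw p)) (fun x =>
      prob (prodLaw fun t => stateLaw μ e (Function.update (x t) i (b t)))
        {s | (fun t => pipeOutput i (b t) (s t)) ∈ B}) =
      prob (prodLaw fun t => erasureChannel (pipeErasure p e i) a (b t)) B := by
  simp only [← pushforward_pipeOutput_joint hp hμ]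
  refine (expect_prodLaw_joint (fun _ => inputLaw p)
    (fun t x => stateLaw μ e (Function.update x i (b t)))
    fun _ s => B.indicator 1 fun t => pipeOutput i (b t) (s t)).trans ?_
  exact (expect_prodLaw_pushforward
    (fun t => joint (inputLaw p) fun x => stateLaw μ e (Function.update x i (b t)))
    (fun t q => pipeOutput i (b t) q.2) (B.indicator 1)).symm

/-- The other bit-pipes only act on bit-pipe `i` through the erasures: averaged over their
codebooks, bit-pipe `i` is a memoryless channel of its own. -/
theorem expect_codebookProb_pipeError (hp : ∀ i, p i ∈ Set.Icc 0 1) {i : Fin N} {a : ℝ}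
    (hμ : pushforward (fun z => z i) μ = bern a) (m : (i : Fin N) → Fin (M i))
    (D : (Fin (M i) → Fin n → Bool) → (Fin n → Option Bool) → Fin (M i)) :
    expect (codebookProb p)
        (fun c => pipeError μ e (fun t i => c i (m i) t) i (D (c i)) (m i)) =
      expect (iid (Fin (M i)) (iid (Fin n) (bern (p i)))) (fun u =>
        prob (prodLaw fun t => erasureChannel (pipeErasure p e i) a (u (m i) t))
          {y | D u y ≠ m i}) := by
  have hbook := prodLaw_mem_stdSimplex fun _ : Fin (M i) => prodLaw_mem_stdSimplex fun _ : Fin n =>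
    bern_mem_stdSimplex (hp i)
  have hupdate (c : (i : Fin N) → Fin (M i) → Fin n → Bool) (u : Fin (M i) → Fin n → Bool)
      (t : Fin n) : (fun k => Function.update c i u k (m k) t) =
        Function.update (fun k => c k (m k) t) i (u (m i) t) := by
    funext k
    exact Function.apply_update (fun k (w : Fin (M k) → Fin n → Bool) => w (m k) t) c i u k
  rw [codebookProb_eq_prodLaw, expect_prodLaw_resample (a := i) hbook.2,
    ← codebookProb_eq_prodLaw, expect_comm]
  congr 1
  funext u
  simp only [pipeError, hupdate, Function.update_self]
  rw [expect_codebookProb_codewords hp m fun x =>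
    prob (prodLaw fun t => stateLaw μ e (Function.update (x t) i (u (m i) t)))
      {s | D u (fun t => pipeOutput i (u (m i) t) (s t)) ≠ m i}]
  exact expect_prob_pipeOutput_update hp hμ (u (m i)) {y | D u y ≠ m i}

theorem eventually_exists_random_codebooks (hp : ∀ i, p i ∈ Set.Icc 0 1)
    (ha : ∀ i, a i ∈ Set.Ioo 0 1) (hμ : ∀ i, pushforward (fun z => z i) μ = bern (a i))
    (he : ∀ x, e x ∈ Set.Icc 0 1)
    (hε : ∀ x : Fin N → Bool, (∀ i, bern (p i) (x i) ≠ 0) → e x ≤ ε) {δ : ℝ} (hδ : 0 < δ) :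
    ∀ᶠ n : ℕ in atTop, ∃ M : Fin N → ℕ, (∀ i, 0 < M i) ∧ (∀ i, p i = 0 → M i = 1) ∧
      (1 - ε) * ∑ i, (binEnt (bconv (p i) (a i)) - binEnt (a i)) - N * δ ≤ IDCode.rate n M ∧
      ∃ D : (i : Fin N) → (Fin (M i) → Fin n → Bool) → (Fin n → Option Bool) → Fin (M i),
        ∀ (m : (i : Fin N) → Fin (M i)) (i : Fin N),
          expect (codebookProb p)
            (fun c => pipeError μ e (fun t i => c i (m i) t) i (D i (c i)) (m i)) ≤ δ := by
  have hpipe := eventually_all.mpr fun i => eventually_exists_random_code_erasureChannel (hp i)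
    (ha i) (pipeErasure_mem_Icc hp he i) (fun b => pipeErasure_le hp hε) hδ
  filter_upwards [hpipe] with n hn
  choose M hM hM1 hrate D hD using hn
  refine ⟨M, hM, hM1, ?_, D, fun m i => ?_⟩
  · calc (1 - ε) * ∑ i, (binEnt (bconv (p i) (a i)) - binEnt (a i)) - N * δ
        = ∑ i, ((1 - ε) * (binEnt (bconv (p i) (a i)) - binEnt (a i)) - δ) := by
          rw [Finset.mul_sum, Finset.sum_sub_distrib]
          simp
      _ ≤ IDCode.rate n M := Finset.sum_le_sum fun i _ => hrate i
  · rw [expect_codebookProb_pipeError hp (hμ i)]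
    exact hD i (m i)

end RandomCodebooks

/-! ### Enforcing the intensity constraints -/

section Weight

variable {N n : ℕ} {A E γ : ℝ}

/-- The number of ones in a sequence of bits. -/
def weight (u : Fin n → Bool) : ℝ := ∑ t, if u t then 1 else 0

open Classical in
/-- The sequence `u` if its weight is at most `r`, and the zero sequence otherwise. -/
noncomputable def trim (r : ℝ) (u : Fin n → Bool) : Fin n → Bool :=
  if weight u ≤ r then u else fun _ => false

theorem weight_trim_le {r : ℝ} (hr : 0 ≤ r) (u : Fin n → Bool) : weight (trim r u) ≤ r := by
  unfold trim
  split_ifs with h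
  · exact h
  · simpa [weight] using hr

theorem eq_false_of_weight_le_zero {u : Fin n → Bool} (h : weight u ≤ 0) (t : Fin n) :
    u t = false := by
  have hterm : ∀ t, (0 : ℝ) ≤ if u t then 1 else 0 := fun t => by split_ifs <;> norm_num
  have ht := (Finset.single_le_sum (fun t _ => hterm t) (Finset.mem_univ t)).trans h
  by_contra hu
  rw [if_pos (Bool.eq_true_of_not_eq_false hu)] at ht
  exact ht.not_gt one_pos

theorem sum_value_eq_sum_weight (x : Fin n → Fin N → Bool) :
    ∑ t, value (x t) = ∑ i, weight (fun t => x t i) * 2 ^ (i : ℕ) := by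
  simp only [value, weight, Finset.sum_mul, ite_mul, one_mul, zero_mul]
  exact Finset.sum_comm

theorem value_le_sum_filter_pos {p : Fin N → ℝ} (hp : ∀ i, 0 ≤ p i) {x : Fin N → Bool}
    (hx : ∀ i, p i = 0 → x i = false) :
    value x ≤ ∑ i ∈ Finset.univ.filter (fun i => 0 < p i), (2 : ℝ) ^ (i : ℕ) := by
  rw [value, ← Finset.sum_filter]
  refine Finset.sum_le_sum_of_subset_of_nonneg (fun i hi => ?_) fun i _ _ => by positivity
  rw [Finset.mem_filter] at hi ⊢
  exact ⟨hi.1, (hp i).lt_of_ne' fun h0 => by simp [hx i h0] at hi⟩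

theorem sum_filter_pos_mul {p : Fin N → ℝ} (hp : ∀ i, 0 ≤ p i) (f : Fin N → ℝ) :
    ∑ i ∈ Finset.univ.filter (fun i => 0 < p i), p i * f i = ∑ i, p i * f i :=
  Finset.sum_subset (Finset.filter_subset _ _) fun i _ hi => by
    simp [(hp i).antisymm' (not_lt.mp (by simpa using hi))]

theorem feasible_of_weight_le {p : Fin N → ℝ} (hp : p ∈ Admissible A E γ N)
    {M : Fin N → ℕ} {C : IDCode N n M} (hC : ∀ i j, weight (C.enc i j) ≤ n * p i) :
    C.Feasible A E γ := by
  obtain ⟨h01, hpeak, havg⟩ := hp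
  have hp0 : ∀ i, 0 ≤ p i := fun i => (h01 i).1
  refine fun m => ⟨fun t => (value_le_sum_filter_pos hp0 fun i hi => ?_).trans hpeak, ?_⟩
  · exact eq_false_of_weight_le_zero (by simpa [hi] using hC i (m i)) t
  · calc ∑ t, value (C.input m t) = ∑ i, weight (C.enc i (m i)) * 2 ^ (i : ℕ) :=
          sum_value_eq_sum_weight _
      _ ≤ ∑ i, n * p i * 2 ^ (i : ℕ) :=
          Finset.sum_le_sum fun i _ => mul_le_mul_of_nonneg_right (hC i _) (by positivity)
      _ = n * ∑ i ∈ Finset.univ.filter (fun i => 0 < p i), p i * 2 ^ (i : ℕ) := by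
          simp only [sum_filter_pos_mul hp0, Finset.mul_sum, mul_assoc]
      _ ≤ n * (γ * E) := mul_le_mul_of_nonneg_left havg n.cast_nonneg

theorem eventually_prob_weight_gt_le {p q δ : ℝ} (hq : q ∈ Set.Icc 0 1) (hp : 0 ≤ p)
    (hqp : q = 0 ∨ q < p) (hδ : 0 < δ) :
    ∀ᶠ n : ℕ in atTop, prob (iid (Fin n) (bern q)) {u | n * p < weight u} ≤ δ := by
  rcases hqp with rfl | hlt
  · refine Eventually.of_forall fun n => (expect_le_of_forall_le (c := 0)
      (prodLaw_mem_stdSimplex fun _ => bern_mem_stdSimplex hq) fun u hu => ?_).trans hδ.le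
    have hzero : ∀ t, u t = false := fun t =>
      eq_false_of_bern_zero_ne_zero (Finset.prod_ne_zero_iff.mp hu t (Finset.mem_univ t))
    have hweight : ¬ n * p < weight u := by
      simpa [weight, hzero] using mul_nonneg n.cast_nonneg hp
    simp [hweight]
  · obtain ⟨ρ, hρ, htail⟩ := exists_prob_sum_nonneg_le_pow (bern_mem_stdSimplex hq)
      (g := fun b => (if b then 1 else 0) - p) (by simp [expect, bern]; linarith)
    filter_upwards [(tendsto_pow_atTop_nhds_zero_of_lt_one hρ.1 hρ.2).eventually_le_const hδ]
      with n hn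
    refine ((prob_mono (prodLaw_mem_stdSimplex fun _ => bern_mem_stdSimplex hq).1
      fun u hu => ?_).trans (htail n)).trans hn
    simpa [weight, Finset.sum_sub_distrib] using hu.out.le

end Weight

section TrimmedCodes

variable {N n : ℕ} {M : Fin N → ℕ} {p q a : Fin N → ℝ} {μ e : (Fin N → Bool) → ℝ} {ε δ : ℝ}

theorem expect_codebookProb_eval (hp : ∀ i, p i ∈ Set.Icc 0 1) (i : Fin N) (j : Fin (M i))
    (F : (Fin n → Bool) → ℝ) :
    expect (codebookProb p) (fun c : (i : Fin N) → Fin (M i) → Fin n → Bool => F (c i j)) =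
      expect (iid (Fin n) (bern (p i))) F := by
  have hword (i) := prodLaw_mem_stdSimplex fun _ : Fin n => bern_mem_stdSimplex (hp i)
  rw [codebookProb_eq_prodLaw]
  refine (expect_prodLaw_eval (κ := fun i => Fin (M i) → Fin n → Bool)
    (fun i => prodLaw_mem_stdSimplex fun _ => hword i) i fun u => F (u j)).trans ?_
  exact expect_prodLaw_eval (fun _ => hword i) j F

theorem pipeError_nonneg (hμ : μ ∈ stdSimplex ℝ (Fin N → Bool)) (he : ∀ x, e x ∈ Set.Icc 0 1)
    (x : Fin n → Fin N → Bool) (i : Fin N) {K : ℕ} (d : (Fin n → Option Bool) → Fin K)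
    (j : Fin K) : 0 ≤ pipeError μ e x i d j :=
  prob_nonneg (prodLaw_mem_stdSimplex fun _ => stateLaw_mem_stdSimplex hμ he _).1 _

theorem pipeError_le_one (hμ : μ ∈ stdSimplex ℝ (Fin N → Bool)) (he : ∀ x, e x ∈ Set.Icc 0 1)
    (x : Fin n → Fin N → Bool) (i : Fin N) {K : ℕ} (d : (Fin n → Option Bool) → Fin K)
    (j : Fin K) : pipeError μ e x i d j ≤ 1 :=
  prob_le_one (prodLaw_mem_stdSimplex fun _ => stateLaw_mem_stdSimplex hμ he _) _

theorem pipeError_trim_le (hμ : μ ∈ stdSimplex ℝ (Fin N → Bool)) (he : ∀ x, e x ∈ Set.Icc 0 1)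
    (r : Fin N → ℝ) (u : Fin N → Fin n → Bool) (i : Fin N) {K : ℕ}
    (d : (Fin n → Option Bool) → Fin K) (j : Fin K) :
    pipeError μ e (fun t k => trim (r k) (u k) t) i d j ≤
      pipeError μ e (fun t k => u k t) i d j +
        ∑ k, {v : Fin n → Bool | r k < weight v}.indicator (1 : (Fin n → Bool) → ℝ) (u k) := by
  have hnonneg : ∀ k ∈ Finset.univ,
      0 ≤ {v : Fin n → Bool | r k < weight v}.indicator (1 : (Fin n → Bool) → ℝ) (u k) :=
    fun k _ => Set.indicator_nonneg (fun _ _ => zero_le_one) _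
  by_cases hall : ∀ k, weight (u k) ≤ r k
  · simp only [trim, if_pos (hall _)]
    exact le_add_of_nonneg_right (Finset.sum_nonneg hnonneg)
  · push Not at hall
    obtain ⟨k, hk⟩ := hall
    have hone := Finset.single_le_sum hnonneg (Finset.mem_univ k)
    rw [Set.indicator_of_mem (show u k ∈ {v | r k < weight v} from hk)] at hone
    exact (pipeError_le_one hμ he _ i d j).trans
      (hone.trans (le_add_of_nonneg_left (pipeError_nonneg hμ he _ i d j)))

theorem exists_smaller_input (hp : ∀ i, p i ∈ Set.Icc 0 1) {F : (Fin N → ℝ) → ℝ}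
    (hF : Continuous F) (hδ : 0 < δ) :
    ∃ q : Fin N → ℝ, (∀ i, q i ∈ Set.Icc 0 1) ∧ (∀ i, q i = 0 ∨ q i < p i) ∧ F p - δ ≤ F q := by
  have hscale : Tendsto (fun η : ℝ => F ((1 - η) • p)) (𝓝[>] 0) (𝓝 (F p)) := by
    refine tendsto_nhdsWithin_of_tendsto_nhds ?_
    simpa using (show Continuous fun η : ℝ => F ((1 - η) • p) by fun_prop).tendsto 0
  obtain ⟨η, hη, hη0, hη1⟩ := ((hscale.eventually_const_le (sub_lt_self _ hδ)).and
    (Ioo_mem_nhdsGT (zero_lt_one' ℝ))).exists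
  refine ⟨(1 - η) • p, fun i => ?_, fun i => ?_, hη⟩
  · exact ⟨mul_nonneg (sub_pos.mpr hη1).le (hp i).1,
      mul_le_one₀ (sub_le_self 1 hη0.le) (hp i).1 (hp i).2⟩
  · rcases (hp i).1.eq_or_lt with h0 | hpos
    · exact Or.inl (by simp [← h0])
    · exact Or.inr (mul_lt_of_lt_one_left hpos (sub_lt_self 1 hη0))

/-- The codes that send the trimmed codewords of a codebook `c` and keep the decoders made out of
the untrimmed codebook. -/
noncomputable def trimCode (r : Fin N → ℝ)
    (D : (i : Fin N) → (Fin (M i) → Fin n → Bool) → (Fin n → Option Bool) → Fin (M i))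
    (c : (i : Fin N) → Fin (M i) → Fin n → Bool) : IDCode N n M where
  enc i j := trim (r i) (c i j)
  dec i := D i (c i)

/-- Codebooks with slightly smaller parameters `q` are trimmed: by the law of large numbers few of
their codewords have a weight above `n * p i`. -/
theorem eventually_exists_random_code_weight_le (hp : ∀ i, p i ∈ Set.Icc 0 1)
    (ha : ∀ i, a i ∈ Set.Ioo 0 1) (hμ : μ ∈ stdSimplex ℝ (Fin N → Bool))
    (hμa : ∀ i, pushforward (fun z => z i) μ = bern (a i)) (he : ∀ x, e x ∈ Set.Icc 0 1)
    (hε : ∀ x : Fin N → Bool, (∀ i, p i = 0 → x i = false) → e x ≤ ε) (hδ : 0 < δ) :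
    ∀ᶠ n : ℕ in atTop, ∃ M : Fin N → ℕ, (∀ i, 0 < M i) ∧
      (1 - ε) * ∑ i, (binEnt (bconv (p i) (a i)) - binEnt (a i)) - δ ≤ IDCode.rate n M ∧
      ∃ w ∈ stdSimplex ℝ ((i : Fin N) → Fin (M i) → Fin n → Bool), ∃ C : _ → IDCode N n M,
        (∀ c i j, weight ((C c).enc i j) ≤ n * p i) ∧
        ∀ (m : (i : Fin N) → Fin (M i)) (i : Fin N),
          expect w (fun c => pipeError μ e ((C c).input m) i ((C c).dec i) (m i)) ≤ δ := by
  have hcont : Continuous fun p : Fin N → ℝ =>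
      (1 - ε) * ∑ i, (binEnt (bconv (p i) (a i)) - binEnt (a i)) := by
    unfold binEnt bconv
    fun_prop
  obtain ⟨q, hq, hqp, hrate⟩ := exists_smaller_input hp hcont (half_pos hδ)
  obtain ⟨η, hη, hηδ⟩ := exists_pos_mul_lt (half_pos hδ) (N + 1 : ℝ)
  have hεq : ∀ x : Fin N → Bool, (∀ i, bern (q i) (x i) ≠ 0) → e x ≤ ε := fun x hx =>
    hε x fun i hi => eq_false_of_bern_zero_ne_zero <|
      (hqp i).resolve_right (hi ▸ (hq i).1.not_gt) ▸ hx i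
  filter_upwards [eventually_exists_random_codebooks hq ha hμa he hεq hη,
    eventually_all.mpr fun i => eventually_prob_weight_gt_le (hq i) (hp i).1 (hqp i) hη]
    with n ⟨M, hM, _, hMrate, D, hD⟩ hweight
  refine ⟨M, hM, by linarith, codebookProb q, codebookProb_mem_stdSimplex hq,
    trimCode (fun i => n * p i) D,
    fun c i j => weight_trim_le (mul_nonneg n.cast_nonneg (hp i).1) _, fun m i => ?_⟩
  have hover : ∀ k, expect (codebookProb q) (fun c : (i : Fin N) → Fin (M i) → Fin n → Bool =>
      {v : Fin n → Bool | n * p k < weight v}.indicator 1 (c k (m k))) ≤ η := fun k =>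
    (expect_codebookProb_eval hq k (m k) _).trans_le (hweight k)
  calc _ ≤ expect (codebookProb q) (fun c => pipeError μ e (fun t k => c k (m k) t) i (D i (c i))
          (m i) + ∑ k, {v : Fin n → Bool | n * p k < weight v}.indicator 1 (c k (m k))) :=
        expect_mono (codebookProb_mem_stdSimplex hq).1 fun c _ =>
          pipeError_trim_le hμ he _ (fun k => c k (m k)) i _ _
    _ ≤ η + ∑ _ : Fin N, η := by
        rw [expect_add, expect_sum]
        exact add_le_add (hD m i) (Finset.sum_le_sum fun k _ => hover k)
    _ ≤ δ := by
        rw [Finset.sum_const, Finset.card_univ, Fintype.card_fin, nsmul_eq_mul]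
        linarith

end TrimmedCodes

/-! ### Deterministic codes -/

section DeterministicCodes

variable {N n : ℕ} {M K : Fin N → ℕ} {p a : Fin N → ℝ} {μ e : (Fin N → Bool) → ℝ} {ε δ : ℝ}

theorem eventually_exists_code_average_le (hp : ∀ i, p i ∈ Set.Icc 0 1)
    (ha : ∀ i, a i ∈ Set.Ioo 0 1) (hμ : μ ∈ stdSimplex ℝ (Fin N → Bool))
    (hμa : ∀ i, pushforward (fun z => z i) μ = bern (a i)) (he : ∀ x, e x ∈ Set.Icc 0 1)
    (hε : ∀ x : Fin N → Bool, (∀ i, p i = 0 → x i = false) → e x ≤ ε) (hδ : 0 < δ) :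
    ∀ᶠ n : ℕ in atTop, ∃ M : Fin N → ℕ, (∀ i, 0 < M i) ∧
      (1 - ε) * ∑ i, (binEnt (bconv (p i) (a i)) - binEnt (a i)) - δ ≤ IDCode.rate n M ∧
      ∃ C : IDCode N n M, (∀ i j, weight (C.enc i j) ≤ n * p i) ∧
        (∑ m : (i : Fin N) → Fin (M i), ∑ i, pipeError μ e (C.input m) i (C.dec i) (m i)) /
          ∏ i, (M i : ℝ) ≤ δ := by
  obtain ⟨η, hη, hηδ⟩ := exists_pos_mul_lt hδ (N : ℝ)
  filter_upwards [eventually_exists_random_code_weight_le hp ha hμ hμa he hε (lt_min hδ hη)]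
    with n ⟨M, hM, hrate, w, hw, C, hC, herr⟩
  have (i : Fin N) : Nonempty (Fin (M i)) := ⟨⟨0, hM i⟩⟩
  obtain ⟨c, hc⟩ := exists_sum_average_le hw fun i m => (herr m i).trans (min_le_right δ η)
  refine ⟨M, hM, by linarith [min_le_left δ η], C c, hC c, ?_⟩
  rw [Finset.sum_comm, Finset.sum_div]
  simpa using hc.trans (by simpa using hηδ.le)

theorem pipeError_congr (he : ∀ x x', e x = e x') {x x' : Fin n → Fin N → Bool} {i : Fin N}
    (hx : ∀ t, x t i = x' t i) {L : ℕ} (d : (Fin n → Option Bool) → Fin L) (j : Fin L) :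
    pipeError μ e x i d j = pipeError μ e x' i d j := by
  have hstate : ∀ t, stateLaw μ e (x t) = stateLaw μ e (x' t) := fun t => by
    funext s
    cases s <;> simp only [stateLaw, he (x t) (x' t)]
  simp only [pipeError, hstate, hx]

theorem pipeError_invFun_le (hμ : μ ∈ stdSimplex ℝ (Fin N → Bool)) (he : ∀ x, e x ∈ Set.Icc 0 1)
    (x : Fin n → Fin N → Bool) (i : Fin N) {L L' : ℕ} [Nonempty (Fin L)] {g : Fin L → Fin L'}
    (hg : g.Injective) (d : (Fin n → Option Bool) → Fin L') (j : Fin L) :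
    pipeError μ e x i (fun y => g.invFun (d y)) j ≤ pipeError μ e x i d (g j) :=
  prob_mono (prodLaw_mem_stdSimplex fun _ => stateLaw_mem_stdSimplex hμ he _).1
    fun _ hs hd => hs ((congrArg g.invFun hd).trans (Function.leftInverse_invFun hg j))

theorem exists_embedding_half {L : ℕ} {f : Fin L → ℝ} (hf : ∀ j, 0 ≤ f j) (hδ : 0 < δ)
    (h : (∑ j, f j) / L ≤ δ) : ∃ g : Fin ((L + 1) / 2) ↪ Fin L, ∀ j, f (g j) ≤ 2 * δ := by
  rcases L.eq_zero_or_pos with rfl | hL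
  · exact ⟨Function.Embedding.refl _, fun j => j.elim0⟩
  let bad := Finset.univ.filter fun j => ¬ f j ≤ 2 * δ
  have hbad : 2 * bad.card ≤ L := by
    have hmarkov : bad.card * (2 * δ) ≤ L * δ :=
      calc bad.card * (2 * δ) = bad.card • (2 * δ) := (nsmul_eq_mul _ _).symm
        _ ≤ ∑ j ∈ bad, f j := Finset.card_nsmul_le_sum _ _ _ fun j hj =>
            (not_le.mp (Finset.mem_filter.mp hj).2).le
        _ ≤ ∑ j, f j := Finset.sum_le_univ_sum_of_nonneg hf
        _ ≤ L * δ := by rwa [div_le_iff₀' (Nat.cast_pos.mpr hL)] at h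
    exact_mod_cast le_of_mul_le_mul_right (by linarith : 2 * (bad.card : ℝ) * δ ≤ L * δ) hδ
  have hcard : _ + bad.card = _ := Finset.card_filter_add_card_filter_not
    (s := (Finset.univ : Finset (Fin L))) (fun j => f j ≤ 2 * δ)
  rw [Finset.card_univ, Fintype.card_fin] at hcard
  have hle : Fintype.card (Fin ((L + 1) / 2)) ≤ Fintype.card {j // f j ≤ 2 * δ} := by
    rw [Fintype.card_subtype, Fintype.card_fin]
    omega
  obtain ⟨g⟩ := Function.Embedding.nonempty_of_card_le hle
  exact ⟨g.trans (Function.Embedding.subtype _), fun j => (g j).2⟩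

theorem rate_sub_div_le_rate_half (hM : ∀ i, 0 < M i) :
    IDCode.rate n M - N / n ≤ IDCode.rate n fun i => (M i + 1) / 2 := by
  have hlog (i : Fin N) : Real.logb 2 (M i) - 1 ≤ Real.logb 2 ((M i + 1) / 2 : ℕ) := by
    have hMi : (0 : ℝ) < M i := Nat.cast_pos.mpr (hM i)
    have hhalf : (M i : ℝ) ≤ 2 * ((M i + 1) / 2 : ℕ) := by
      exact_mod_cast (by omega : M i ≤ 2 * ((M i + 1) / 2))
    calc Real.logb 2 (M i) - 1 = Real.logb 2 (M i / 2) := by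
          rw [Real.logb_div hMi.ne' two_ne_zero, Real.logb_self_eq_one one_lt_two]
      _ ≤ _ := Real.logb_le_logb_of_le one_lt_two (by positivity) (by linarith)
  calc IDCode.rate n M - N / n = ∑ i, (Real.logb 2 (M i) - 1) / n := by
        simp [IDCode.rate, sub_div, Finset.sum_sub_distrib, ← div_eq_mul_inv]
    _ ≤ _ := Finset.sum_le_sum fun i _ => div_le_div_of_nonneg_right (hlog i) n.cast_nonneg

/-- The code that only uses the messages in the range of `g`. -/
noncomputable def IDCode.restrict (C : IDCode N n M) (g : (i : Fin N) → Fin (K i) → Fin (M i))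
    [∀ i, Nonempty (Fin (K i))] : IDCode N n K where
  enc i j := C.enc i (g i j)
  dec i y := (g i).invFun (C.dec i y)

/-- For a constant erasure probability the error probability of bit-pipe `i` only depends on the
message `m i`, hence bad messages can be expurgated on each bit-pipe separately. -/
theorem exists_expurgated_code (hμ : μ ∈ stdSimplex ℝ (Fin N → Bool))
    (he : ∀ x, e x ∈ Set.Icc 0 1) (hconst : ∀ x x', e x = e x') (hM : ∀ i, 0 < M i)
    (C : IDCode N n M) (m₀ : (i : Fin N) → Fin (M i)) (hδ : 0 < δ)
    (h : ∑ i, (∑ j, pipeError μ e (C.input (Function.update m₀ i j)) i (C.dec i) j) / M i ≤ δ) :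
    ∃ C' : IDCode N n fun i => (M i + 1) / 2, (∀ i j, ∃ j', C'.enc i j = C.enc i j') ∧
      ∀ m i, pipeError μ e (C'.input m) i (C'.dec i) (m i) ≤ 2 * δ := by
  have hnonneg (i : Fin N) (j : Fin (M i)) :
      0 ≤ pipeError μ e (C.input (Function.update m₀ i j)) i (C.dec i) j :=
    pipeError_nonneg hμ he _ i _ j
  have haverage (i : Fin N) := (Finset.single_le_sum (f := fun i => (∑ j, pipeError μ e
    (C.input (Function.update m₀ i j)) i (C.dec i) j) / M i)
    (fun i _ => div_nonneg (Finset.sum_nonneg fun j _ => hnonneg i j) (M i).cast_nonneg)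
    (Finset.mem_univ i)).trans h
  choose g hg using fun i => exists_embedding_half (hnonneg i) hδ (haverage i)
  have (i : Fin N) : Nonempty (Fin ((M i + 1) / 2)) := ⟨⟨0, by have := hM i; omega⟩⟩
  refine ⟨C.restrict fun i => g i, fun i j => ⟨g i j, rfl⟩, fun m i => ?_⟩
  refine (pipeError_invFun_le hμ he _ i (g i).injective _ _).trans ?_
  rw [pipeError_congr hconst (x' := C.input (Function.update m₀ i (g i (m i)))) fun t => by
    simp [IDCode.input, IDCode.restrict]]
  exact hg i (m i)

theorem eventually_exists_code_forall_le (hp : ∀ i, p i ∈ Set.Icc 0 1)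
    (ha : ∀ i, a i ∈ Set.Ioo 0 1) (hμ : μ ∈ stdSimplex ℝ (Fin N → Bool))
    (hμa : ∀ i, pushforward (fun z => z i) μ = bern (a i)) (he : ∀ x, e x ∈ Set.Icc 0 1)
    (hconst : ∀ x x', e x = e x')
    (hε : ∀ x : Fin N → Bool, (∀ i, p i = 0 → x i = false) → e x ≤ ε) (hδ : 0 < δ) :
    ∀ᶠ n : ℕ in atTop, ∃ M : Fin N → ℕ, (∀ i, 0 < M i) ∧
      (1 - ε) * ∑ i, (binEnt (bconv (p i) (a i)) - binEnt (a i)) - δ ≤ IDCode.rate n M ∧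
      ∃ C : IDCode N n M, (∀ i j, weight (C.enc i j) ≤ n * p i) ∧
        ∀ m i, pipeError μ e (C.input m) i (C.dec i) (m i) ≤ δ := by
  obtain ⟨η, hη, hηδ⟩ := exists_pos_mul_lt (half_pos hδ) (N : ℝ)
  filter_upwards [eventually_exists_random_code_weight_le hp ha hμ hμa he hε
    (lt_min (half_pos hδ) hη), (tendsto_const_div_atTop_nhds_zero_nat (N : ℝ)).eventually_le_const
      (half_pos hδ)] with n ⟨M, hM, hrate, w, hw, C, hC, herr⟩ hloss
  have (i : Fin N) : Nonempty (Fin (M i)) := ⟨⟨0, hM i⟩⟩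
  let m₀ (i : Fin N) : Fin (M i) := ⟨0, hM i⟩
  obtain ⟨c, hc⟩ := exists_sum_average_le hw (F := fun i j c =>
    pipeError μ e ((C c).input (Function.update m₀ i j)) i ((C c).dec i) j) fun i j => by
      simpa using (herr (Function.update m₀ i j) i).trans (min_le_right _ η)
  simp only [Fintype.card_fin] at hc
  obtain ⟨C', henc, herr'⟩ := exists_expurgated_code hμ he hconst hM (C c) m₀ (half_pos hδ)
    (hc.trans hηδ.le)
  refine ⟨_, fun i => by have := hM i; omega, ?_, C', fun i j => ?_, fun m i => ?_⟩
  · linarith [rate_sub_div_le_rate_half (n := n) hM, min_le_left (δ / 2) η]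
  · obtain ⟨j', hj'⟩ := henc i j
    exact hj' ▸ hC c i j'
  · linarith [herr' m i]

end DeterministicCodes

/-! ### The law of the noise bits -/

section NoiseLaw

theorem gaussQ_strictAnti : StrictAnti gaussQ := by
  intro a b hab
  have hint : MeasureTheory.Integrable (fun u : ℝ => Real.exp (-u ^ 2 / 2)) := by
    simpa [neg_div, div_eq_inv_mul] using integrable_exp_neg_mul_sq (b := 1 / 2) (by norm_num)
  have hpos : 0 < ∫ u in a..b, Real.exp (-u ^ 2 / 2) :=
    intervalIntegral.intervalIntegral_pos_of_pos hint.intervalIntegrable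
      (fun u => Real.exp_pos _) hab
  rw [← intervalIntegral.integral_Ioi_sub_Ioi hint.integrableOn hab.le, sub_pos] at hpos
  exact mul_lt_mul_of_pos_left hpos (by positivity)

theorem sum_Ico_sub_add_one (F : ℤ → ℝ) {a b : ℤ} (hab : a ≤ b) :
    ∑ k ∈ Finset.Ico a b, (F k - F (k + 1)) = F a - F b := by
  induction b, hab using Int.leInduction with
  | base => simp
  | succ b hab ih =>
    rw [← Finset.insert_Ico_right_eq_Ico_add_one hab, Finset.sum_insert (by simp), ih]
    ring

theorem noiseBits_zero {N : ℕ} (i : Fin N) : noiseBits N 0 i = false := by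
  simp [noiseBits]

theorem noiseBits_neg_one {N : ℕ} (i : Fin N) : noiseBits N (-1) i = true := by
  have hquot : ((2 : ℤ) ^ N + -1) / 2 ^ (i : ℕ) = 2 * 2 ^ (N - 1 - i) - 1 := by
    have hpow : (2 : ℤ) ^ N = 2 ^ (i : ℕ) * (2 * 2 ^ (N - 1 - i)) := by
      rw [← pow_succ', ← pow_add]
      congr 1
      lia
    have hi : (0 : ℤ) < 2 ^ (i : ℕ) := by positivity
    rw [hpow, Int.ediv_eq_iff_of_pos hi]
    constructor <;> linarith
  rw [noiseBits, if_pos (by norm_num), hquot]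
  simp

/-- The law of the vector of noise bits. -/
noncomputable def noiseLaw (A β γ : ℝ) (N : ℕ) : (Fin N → Bool) → ℝ :=
  pushforward (fun k : noiseSupport A β γ => noiseBits N k) fun k => noiseMass A β γ k

theorem pushforward_noiseLaw {T : Type*} [DecidableEq T] {A β γ : ℝ} {N : ℕ}
    (g : (Fin N → Bool) → T) (y : T) :
    pushforward g (noiseLaw A β γ N) y =
      ∑ k ∈ (noiseSupport A β γ).filter (fun k => g (noiseBits N k) = y), noiseMass A β γ k := by
  rw [noiseLaw, pushforward_apply, expect_pushforward, expect, Finset.sum_filter]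
  simp only [Function.comp_apply, mul_ite, mul_one, mul_zero]
  exact Finset.sum_coe_sort _ fun k => if g (noiseBits N k) = y then noiseMass A β γ k else 0

variable {A β γ : ℝ} (hA : 0 < A) (hβ : 0 < β) (hγ : 0 < γ)

include hA hβ hγ

theorem neg_one_zero_mem_noiseSupport :
    -1 ∈ noiseSupport A β γ ∧ 0 ∈ noiseSupport A β γ := by
  have hlow : 0 < ⌈γ * A⌉ := Int.ceil_pos.mpr (by positivity)
  have hhigh : 0 < ⌈γ * (A + 2 * β)⌉ := Int.ceil_pos.mpr (by positivity)
  simp only [noiseSupport, Finset.mem_Ico]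
  lia

theorem noiseNorm_pos : 0 < noiseNorm A β γ := by
  have hlt : (-⌈γ * A⌉ : ℝ) < ⌈γ * (A + 2 * β)⌉ :=
    mod_cast Finset.nonempty_Ico.mp ⟨0, (neg_one_zero_mem_noiseSupport hA hβ hγ).2⟩
  exact sub_pos.mpr (gaussQ_strictAnti (by gcongr))

theorem noiseMass_pos (k : ℤ) : 0 < noiseMass A β γ k :=
  div_pos (sub_pos.mpr (gaussQ_strictAnti (by gcongr; linarith))) (noiseNorm_pos hA hβ hγ)

theorem sum_noiseMass : ∑ k ∈ noiseSupport A β γ, noiseMass A β γ k = 1 := by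
  have hlt := Finset.nonempty_Ico.mp ⟨0, (neg_one_zero_mem_noiseSupport hA hβ hγ).2⟩
  have htel := sum_Ico_sub_add_one (fun k => gaussQ (((k : ℝ) - γ * β) / γ)) hlt.le
  push_cast at htel
  simp only [noiseMass, noiseSupport, ← Finset.sum_div]
  rw [htel]
  exact div_self (noiseNorm_pos hA hβ hγ).ne'

theorem noiseLaw_mem_stdSimplex (N : ℕ) : noiseLaw A β γ N ∈ stdSimplex ℝ (Fin N → Bool) :=
  pushforward_mem_stdSimplex _ ⟨fun k => (noiseMass_pos hA hβ hγ k).le,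
    (Finset.sum_coe_sort _ _).trans (sum_noiseMass hA hβ hγ)⟩

theorem crossover_mem_Ioo {N : ℕ} (i : Fin N) : crossover A β γ N i ∈ Set.Ioo 0 1 := by
  obtain ⟨hneg, hzero⟩ := neg_one_zero_mem_noiseSupport hA hβ hγ
  constructor
  · exact Finset.sum_pos (fun k _ => noiseMass_pos hA hβ hγ k)
      ⟨-1, Finset.mem_filter.mpr ⟨hneg, noiseBits_neg_one i⟩⟩
  · rw [← sum_noiseMass hA hβ hγ]
    exact Finset.sum_lt_sum_of_subset (Finset.filter_subset _ _) hzero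
      (by simp [noiseBits_zero]) (noiseMass_pos hA hβ hγ 0)
      fun k _ _ => (noiseMass_pos hA hβ hγ k).le

theorem pushforward_eval_noiseLaw {N : ℕ} (i : Fin N) :
    pushforward (fun z => z i) (noiseLaw A β γ N) = bern (crossover A β γ N i) := by
  have htrue : pushforward (fun z => z i) (noiseLaw A β γ N) true = crossover A β γ N i :=
    pushforward_noiseLaw _ _
  have hsum := (pushforward_mem_stdSimplex (fun z => z i)
    (noiseLaw_mem_stdSimplex hA hβ hγ N)).2
  rw [Fintype.sum_bool] at hsum
  funext b
  cases b with
  | true => simpa [bern] using htrue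
  | false =>
    rw [bern]
    simp only [Bool.false_eq_true, if_false]
    linarith

end NoiseLaw

/-! ### Reduction to a receiver that knows the carry-over bits -/

section Reduction

variable {N n : ℕ} {M : Fin N → ℕ} {A β γ : ℝ} {e : (Fin N → Bool) → ℝ}

theorem trans_eq_pushforward (A β γ : ℝ) (e : (Fin N → Bool) → ℝ) (x : Fin N → Bool) :
    trans A β γ e x = pushforward (Option.map (output x)) (stateLaw (noiseLaw A β γ N) e x) := by
  funext y
  rw [pushforward_apply, expect, Fintype.sum_option]
  cases y with
  | none => simp [trans, stateLaw]
  | some y =>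
    simp only [trans, ← pushforward_noiseLaw, pushforward_apply, expect, stateLaw, Finset.mul_sum,
      mul_assoc, Option.map_none, Option.map_some, Option.some.injEq, reduceCtorEq, if_false,
      mul_zero, zero_add]

namespace IDCode

variable (C : IDCode N n M) (m : (i : Fin N) → Fin (M i)) {s : Fin n → Option (Fin N → Bool)}

theorem cleaned_output {i : Fin N} {w : Fin n → Bool}
    (hw : ∀ t z, s t = some z → w t = carry (C.input m t) z i) :
    cleaned (fun t => (s t).map (output (C.input m t))) i w =
      fun t => pipeOutput i (C.input m t i) (s t) := by
  funext t
  cases hs : s t with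
  | none => simp [cleaned, pipeOutput, hs]
  | some z => simp [cleaned, pipeOutput, hs, output, hw t z hs]

theorem carryEst_eq_carry (hd : ∀ i, C.dec i (fun t => pipeOutput i (C.input m t i) (s t)) = m i)
    (i : ℕ) : ∀ t z, s t = some z →
      C.carryEst (fun t => (s t).map (output (C.input m t))) i t = carry (C.input m t) z i := by
  induction i with
  | zero => exact fun _ _ _ => rfl
  | succ i ih =>
    intro t z hs
    by_cases hi : i < N
    · have hcancel : ∀ a b : Bool, xor (xor a b) a = b := by decide
      simp only [carryEst, carry, dif_pos hi]
      rw [C.cleaned_output m (i := ⟨i, hi⟩) ih, hd]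
      simp only [pipeOutput, hs, Option.map_some, ih t z hs, input, hcancel]
    · simp only [carryEst, carry, dif_neg hi]

theorem decode_eq (hd : ∀ i, C.dec i (fun t => pipeOutput i (C.input m t i) (s t)) = m i) :
    C.decode (fun t => (s t).map (output (C.input m t))) = m := by
  funext i
  rw [decode, C.cleaned_output m (C.carryEst_eq_carry m hd i), hd]

theorem errorProb_eq_prob (A β γ : ℝ) (e : (Fin N → Bool) → ℝ) :
    C.errorProb A β γ e m = prob (prodLaw fun t => stateLaw (noiseLaw A β γ N) e (C.input m t))
      {s | C.decode (fun t => (s t).map (output (C.input m t))) ≠ m} := by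
  calc C.errorProb A β γ e m
      = prob (prodLaw fun t => trans A β γ e (C.input m t)) {y | C.decode y ≠ m} := by
        rw [errorProb, prob, expect]
        refine Finset.sum_congr rfl fun y _ => ?_
        by_cases hy : C.decode y = m <;> simp [hy, prodLaw]
    _ = _ := by
        simp only [trans_eq_pushforward]
        exact expect_prodLaw_pushforward _ _ _

theorem errorProb_le_sum_pipeError (hμ : noiseLaw A β γ N ∈ stdSimplex ℝ (Fin N → Bool))
    (he : ∀ x, e x ∈ Set.Icc 0 1) :
    C.errorProb A β γ e m ≤
      ∑ i, pipeError (noiseLaw A β γ N) e (C.input m) i (C.dec i) (m i) := by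
  have hlaw := (prodLaw_mem_stdSimplex fun t => stateLaw_mem_stdSimplex hμ he (C.input m t)).1
  rw [errorProb_eq_prob]
  refine (prob_mono hlaw fun s hs => ?_).trans (prob_iUnion_le hlaw Finset.univ _)
  by_contra hd
  simp only [Set.mem_iUnion, Finset.mem_univ, Set.mem_ofPred_eq, exists_prop, true_and, not_exists,
    not_not] at hd
  exact hs (C.decode_eq m hd)

end IDCode

end Reduction

/-! ### Achievable rates -/

section Achievability

variable {N : ℕ} {A E β γ ε : ℝ} {e : (Fin N → Bool) → ℝ} {p : Fin N → ℝ}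
  (hA : 0 < A) (hβ : 0 < β) (hγ : 0 < γ) (he : ∀ x, e x ∈ Set.Icc 0 1)

include hA hβ hγ he

theorem ensembleAchieves (hp : ∀ i, p i ∈ Set.Icc 0 1)
    (hε : ∀ x : Fin N → Bool, (∀ i, p i = 0 → x i = false) → e x ≤ ε) :
    EnsembleAchieves A β γ e p ((1 - ε) * sumRate A β γ p) := by
  intro δ hδ
  have hμ := noiseLaw_mem_stdSimplex hA hβ hγ N
  obtain ⟨η, hη, hηδ⟩ := exists_pos_mul_lt hδ (N : ℝ)
  obtain ⟨n₀, hn₀⟩ := eventually_atTop.mp <| eventually_exists_random_codebooks hp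
    (crossover_mem_Ioo hA hβ hγ) (pushforward_eval_noiseLaw hA hβ hγ) he
    (fun x hx => hε x fun i hi => eq_false_of_bern_zero_ne_zero (hi ▸ hx i)) hη
  refine ⟨n₀, fun n hn => ?_⟩
  obtain ⟨M, hM, hM1, hrate, D, hD⟩ := hn₀ n hn
  refine ⟨M, hM, hM1, (sub_le_sub_left hηδ.le _).trans hrate, D, fun m => ?_⟩
  calc expect (codebookProb p) (fun c => (IDCode.mk c fun i => D i (c i)).errorProb A β γ e m)
      ≤ expect (codebookProb p) (fun c => ∑ i, pipeError (noiseLaw A β γ N) e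
          (fun t i => c i (m i) t) i (D i (c i)) (m i)) :=
        expect_mono (codebookProb_mem_stdSimplex hp).1
          fun c _ => IDCode.errorProb_le_sum_pipeError _ m hμ he
    _ ≤ N * η := by
        rw [expect_sum]
        simpa using Finset.sum_le_card_nsmul Finset.univ _ η fun i _ => hD m i
    _ ≤ δ := hηδ.le

theorem achievableAvg (hp : p ∈ Admissible A E γ N)
    (hε : ∀ x : Fin N → Bool, (∀ i, p i = 0 → x i = false) → e x ≤ ε) :
    AchievableAvg A E β γ e ((1 - ε) * sumRate A β γ p) := by
  intro δ hδ
  have hμ := noiseLaw_mem_stdSimplex hA hβ hγ N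
  obtain ⟨n₀, hn₀⟩ := eventually_atTop.mp <| eventually_exists_code_average_le hp.1
    (crossover_mem_Ioo hA hβ hγ) hμ (pushforward_eval_noiseLaw hA hβ hγ) he hε hδ
  refine ⟨n₀, fun n hn => ?_⟩
  obtain ⟨M, hM, hrate, C, hC, herr⟩ := hn₀ n hn
  refine ⟨M, hM, hrate, C, feasible_of_weight_le hp hC, le_trans ?_ herr⟩
  exact div_le_div_of_nonneg_right
    (Finset.sum_le_sum fun m _ => C.errorProb_le_sum_pipeError m hμ he)
    (Finset.prod_nonneg fun i _ => (M i).cast_nonneg)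

theorem achievableMax (hconst : ∀ x x', e x = e x') (hp : p ∈ Admissible A E γ N)
    (hε : ∀ x : Fin N → Bool, (∀ i, p i = 0 → x i = false) → e x ≤ ε) :
    AchievableMax A E β γ e ((1 - ε) * sumRate A β γ p) := by
  intro δ hδ
  have hμ := noiseLaw_mem_stdSimplex hA hβ hγ N
  obtain ⟨η, hη, hηδ⟩ := exists_pos_mul_lt hδ (N : ℝ)
  obtain ⟨n₀, hn₀⟩ := eventually_atTop.mp <| eventually_exists_code_forall_le hp.1
    (crossover_mem_Ioo hA hβ hγ) hμ (pushforward_eval_noiseLaw hA hβ hγ) he hconst hε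
    (lt_min hδ hη)
  refine ⟨n₀, fun n hn => ?_⟩
  obtain ⟨M, hM, hrate, C, hC, herr⟩ := hn₀ n hn
  refine ⟨M, hM, (sub_le_sub_left (min_le_left δ η) _).trans hrate, C,
    feasible_of_weight_le hp hC, fun m => ?_⟩
  calc C.errorProb A β γ e m
      ≤ ∑ i, pipeError (noiseLaw A β γ N) e (C.input m) i (C.dec i) (m i) :=
        C.errorProb_le_sum_pipeError m hμ he
    _ ≤ N * η := by
        simpa using Finset.sum_le_card_nsmul Finset.univ _ η fun i _ =>
          (herr m i).trans (min_le_right δ η)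
    _ ≤ δ := hηδ.le

end Achievability

/-! ### The optimal parameters -/

section Optimum

variable {N : ℕ} {A E β γ : ℝ}

theorem continuous_sumRate (A β γ : ℝ) : Continuous (sumRate A β γ (N := N)) := by
  unfold sumRate binEnt bconv
  fun_prop

theorem zero_mem_admissible (hA : 0 < A) (hE : 0 < E) (hγ : 0 < γ) :
    (0 : Fin N → ℝ) ∈ Admissible A E γ N :=
  ⟨fun _ => ⟨le_rfl, zero_le_one⟩, by simpa using (mul_pos hγ hA).le,
    by simpa using (mul_pos hγ hE).le⟩

theorem isCompact_admissible (A E γ : ℝ) (N : ℕ) : IsCompact (Admissible A E γ N) := by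
  have hunion : Admissible A E γ N =
      ⋃ s ∈ {s : Finset (Fin N) | ∑ i ∈ s, (2 : ℝ) ^ (i : ℕ) ≤ γ * A},
        (Set.Icc 0 1 ∩ {p : Fin N → ℝ | (∀ i, i ∉ s → p i = 0) ∧
          ∑ i, p i * (2 : ℝ) ^ (i : ℕ) ≤ γ * E}) := by
    ext p
    simp only [Set.mem_iUnion, Set.mem_ofPred_eq, exists_prop, Set.mem_inter_iff, Set.mem_Icc,
      Pi.le_def, Pi.zero_apply, Pi.one_apply, Admissible]
    constructor
    · rintro ⟨h01, hA, hE⟩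
      refine ⟨_, hA, ⟨fun i => (h01 i).1, fun i => (h01 i).2⟩, fun i hi => ?_, ?_⟩
      · exact (h01 i).1.antisymm' (not_lt.mp (by simpa using hi))
      · rwa [sum_filter_pos_mul fun i => (h01 i).1] at hE
    · rintro ⟨s, hA, ⟨h0, h1⟩, hs, hE⟩
      refine ⟨fun i => ⟨h0 i, h1 i⟩, le_trans ?_ hA, by rwa [sum_filter_pos_mul h0]⟩
      refine Finset.sum_le_sum_of_subset_of_nonneg (fun i hi => ?_) fun i _ _ => by positivity
      by_contra his
      exact (Finset.mem_filter.mp hi).2.ne' (hs i his)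
  rw [hunion]
  refine (Set.toFinite _).isCompact_biUnion fun s _ => isCompact_Icc.inter_right ?_
  simp only [Set.ofPred_and, Set.ofPred_forall]
  exact (isClosed_iInter fun i => isClosed_iInter fun _ =>
    isClosed_eq (by fun_prop) (by fun_prop)).inter (isClosed_le (by fun_prop) continuous_const)

theorem exists_isGreatest_sumRate (β : ℝ) (hA : 0 < A) (hE : 0 < E) (hγ : 0 < γ) :
    ∃ S, IsGreatest (sumRate A β γ '' Admissible A E γ N) S :=
  ((isCompact_admissible A E γ N).image (continuous_sumRate A β γ)).exists_isGreatest
    (Set.Nonempty.image _ ⟨0, zero_mem_admissible hA hE hγ⟩)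

end Optimum

end VBC

theorem theorem2_general (A E β γ ε : ℝ) (hA : 0 < A) (hE : 0 < E) (hβ : 0 < β) (hγ : 0 < γ)
    (N : ℕ) (e : (Fin N → Bool) → ℝ) (he : ∀ x, 0 ≤ e x ∧ e x ≤ 1)
    (he' : ∀ x, VBC.value x ≤ γ * A → e x ≤ ε) :
    ∃ S : ℝ, IsGreatest (VBC.sumRate A β γ '' VBC.Admissible A E γ N) S ∧
      (∀ p ∈ VBC.Admissible A E γ N,
        VBC.EnsembleAchieves A β γ e p ((1 - ε) * VBC.sumRate A β γ p)) ∧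
      VBC.AchievableAvg A E β γ e ((1 - ε) * S) ∧
      ((∀ x x', e x = e x') → VBC.AchievableMax A E β γ e ((1 - ε) * S)) := by
  have hε : ∀ p ∈ VBC.Admissible A E γ N, ∀ x : Fin N → Bool,
      (∀ i, p i = 0 → x i = false) → e x ≤ ε := fun p hp x hx =>
    he' x ((VBC.value_le_sum_filter_pos (fun i => (hp.1 i).1) hx).trans hp.2.1)
  obtain ⟨S, hS⟩ := VBC.exists_isGreatest_sumRate (N := N) β hA hE hγ
  obtain ⟨p, hp, rfl⟩ := hS.1
  exact ⟨_, hS, fun q hq => VBC.ensembleAchieves hA hβ hγ he hq.1 (hε q hq),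
    VBC.achievableAvg hA hβ hγ he hp (hε p hp),
    fun hconst => VBC.achievableMax hA hβ hγ he hconst hp (hε p hp)⟩

theorem theorem2 (A E β γ : ℝ) (hA : 0 < A) (hE : 0 < E) (hβ : 0 < β) (hγ : 0 < γ)
    (N : ℕ) (hN : N = VBC.numBits A β γ)
    (e : (Fin N → Bool) → ℝ) (he : ∀ x, 0 ≤ e x ∧ e x ≤ 1)
    (he' : ∀ x, VBC.value x ≤ γ * A → e x ≤ VBC.erasureBound β) :
    ∃ S : ℝ, IsGreatest (VBC.sumRate A β γ '' VBC.Admissible A E γ N) S ∧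
      (∀ p ∈ VBC.Admissible A E γ N,
        VBC.EnsembleAchieves A β γ e p ((1 - VBC.erasureBound β) * VBC.sumRate A β γ p)) ∧
      VBC.AchievableAvg A E β γ e ((1 - VBC.erasureBound β) * S) ∧
      ((∀ x x', e x = e x') →
        VBC.AchievableMax A E β γ e ((1 - VBC.erasureBound β) * S)) :=
  theorem2_general A E β γ _ hA hE hβ hγ N e he he'
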